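/- Let $I=[x_\ell,x_r]$ and $J=[y_b,y_t]$ be closed intervals in $\mathbb{R}$ with $x_\ell<x_r$ and $y_b<y_t$, let $n\ge 1$, and let $Q$ be a metric space with an isometry $e$ from $Q$ onto the rectangle $\{z\in\mathbb{C} : \operatorname{Re} z\in I,\ \operatorname{Im} z\in J\}$, by which we identify $Q$ with this rectangle. Let $\mathrm{Mult}_n(Q)=Q^n/\mathrm{Sym}_n$ be the space of $n$-element multisets in $Q$, with the quotient metric $d([z],[w])=\min_{\sigma\in \mathrm{Sym}_n}\bigl(\sum_i d(z_i,w_{\sigma(i)})^2\bigr)^{1/2}$. A rectangular composition of $n$ is an $(h+2)\times(k+2)$ matrix of nonnegative integers ($h,k\ge 0$) with entry sum $n$ in which no internal (neither first nor last) row and no internal column is zero. $\mathrm{Comp}_n(\square)$ is the set of all rectangular compositions of $n$, ordered by $a\le b$ if and only if $a$ is obtained from $b$ by a finite (possibly empty) sequence of row-merges (replacing two adjacent rows by their sum) and column-merges (replacing two adjacent columns by their sum), all the matrices in the sequence being rectangular compositions. For $z\in\mathrm{Mult}_n(Q)$, let $x_\ell=x_0<x_1<\cdots<x_h<x_{h+1}=x_r$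 be the points of $I$ that are endpoints of $I$ or real parts of points of $z$, and let $y_b=y_0<y_1<\cdots<y_k<y_{k+1}=y_t$ be the points of $J$ that are endpoints of $J$ or imaginary parts of points of $z$; then $\mathrm{Comp}(z)\in\mathrm{Comp}_n(\square)$ is the matrix whose $(i,j)$ entry is the multiplicity of $x_i+\mathrm{i}\,y_j$ in $z$. A $d$-dimensional orthoscheme is the convex hull of points $p_0,\ p_0+v_1,\ \dots,\ p_0+v_1+\cdots+v_d$ in a Euclidean space, where $v_1,\dots,v_d$ are nonzero and pairwise orthogonal ($d\ge0$); a bi-orthoscheme is a metric space isometric to the $\ell^2$-product of two orthoschemes. A piecewise Euclidean cell complex is a quotient of a disjoint union of convex Euclidean polytopes such that the quotient map is injective on the relative interior of every face of each polytope and, whenever it identifies a point in the relative interior of a face $F$ with a point in the relative interior of a face $G$, there is an isometry $g\colon F\to G$ such that it identifies $y$ with $g(y)$ for all $y\in F$. The complex carries the intrinsic (pseudo)metric: the infimum of the total lengths of finite strings of points in which consecutive points lie in a common polytope. Its cells are the images of the nonempty faces of the polytopes, and its face poset is the set of its cells ordered by inclusion. Then there are a piecewise Euclidean cell complex $K$,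 an isometry $f$ from $K$ onto $\mathrm{Mult}_n(Q)$, and an isomorphism of posets $\varphi$ from the face poset of $K$ onto $\mathrm{Comp}_n(\square)$ such that every face $F$ of every polytope of $K$ is a bi-orthoscheme and, if $S$ is the cell that is the image of $F$, then $f$ maps the open cell of $S$ (the image of the relative interior of $F$) onto $\{z\in\mathrm{Mult}_n(Q) : \mathrm{Comp}(z)=\varphi(S)\}$. -/

import Mathlib

open scoped ENNReal

noncomputable section

/-! ### Multiset spaces -/

/-- Two `n`-tuples are equivalent if they differ by a permutation of the coordinates. -/
def permSetoid (n : ℕ) (X : Type*) : Setoid (Fin n → X) where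
  r z w := ∃ σ : Equiv.Perm (Fin n), z = w ∘ σ
  iseqv :=
    { refl := fun _ => ⟨1, rfl⟩
      symm := by
        rintro z w ⟨σ, rfl⟩
        exact ⟨σ⁻¹, by ext i; simp⟩
      trans := by
        rintro z w u ⟨σ, rfl⟩ ⟨τ, rfl⟩
        exact ⟨τ * σ, by ext i; simp⟩ }

/-- The multiset space `Xⁿ / Sym_n`. -/
def Mult (n : ℕ) (X : Type*) : Type _ := Quotient (permSetoid n X)

namespace Mult

variable {n : ℕ} {X Y : Type*}

/-- The multiset of the entries of a tuple. -/
def mk (z : Fin n → X) : Mult n X := Quotient.mk (permSetoid n X) z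

/-- The map of multiset spaces induced by a map of spaces. -/
def map (f : X → Y) : Mult n X → Mult n Y :=
  Quotient.lift (s := permSetoid n X) (fun z => mk (f ∘ z)) (by
    rintro z w ⟨σ, rfl⟩
    exact Quotient.sound (s := permSetoid n Y) ⟨σ, rfl⟩)

/-- The multiplicity of a point in a multiset. -/
def count (z : Mult n X) (x : X) : ℕ :=
  Quotient.lift (s := permSetoid n X) (fun w => Nat.card {i : Fin n // w i = x}) (by
    rintro z w ⟨σ, rfl⟩
    exact Nat.card_congr (σ.subtypeEquiv (fun i => Iff.rfl))) z

section Metric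

variable [MetricSpace X]

/-- The `ℓ²` distance on `Xⁿ`. -/
def tupleDist (z w : Fin n → X) : ℝ := dist (WithLp.toLp 2 z) (WithLp.toLp 2 w)

theorem tupleDist_comp (z w : Fin n → X) (σ : Equiv.Perm (Fin n)) :
    tupleDist (z ∘ σ) (w ∘ σ) = tupleDist z w := by
  have h2 : 0 < (2 : ℝ≥0∞).toReal := by norm_num
  simp only [tupleDist, PiLp.dist_eq_sum h2, Function.comp]
  rw [Equiv.sum_comp σ (fun i => dist (z i) (w i) ^ (2 : ℝ≥0∞).toReal)]

/-- The distance between the orbits of two tuples. -/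
def orbitDist (z w : Fin n → X) : ℝ := ⨅ σ : Equiv.Perm (Fin n), tupleDist z (w ∘ σ)

theorem orbitDist_le (z w : Fin n → X) (σ : Equiv.Perm (Fin n)) :
    orbitDist z w ≤ tupleDist z (w ∘ σ) :=
  ciInf_le (Set.finite_range _).bddBelow σ

theorem exists_orbitDist_eq (z w : Fin n → X) :
    ∃ σ : Equiv.Perm (Fin n), tupleDist z (w ∘ σ) = orbitDist z w :=
  exists_eq_ciInf_of_finite

theorem orbitDist_comp_right (z w : Fin n → X) (τ : Equiv.Perm (Fin n)) :
    orbitDist z (w ∘ τ) = orbitDist z w := by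
  unfold orbitDist
  exact (Equiv.mulLeft τ).iInf_congr (fun σ => rfl)

theorem orbitDist_comm (z w : Fin n → X) : orbitDist z w = orbitDist w z := by
  have key : ∀ z w : Fin n → X, orbitDist z w ≤ orbitDist w z := by
    intro z w
    obtain ⟨σ, hσ⟩ := exists_orbitDist_eq w z
    refine (orbitDist_le z w σ⁻¹).trans (le_of_eq ?_)
    rw [← hσ, ← tupleDist_comp z (w ∘ ⇑σ⁻¹) σ]
    have : (w ∘ ⇑σ⁻¹) ∘ ⇑σ = w := by ext i; simp
    rw [this]
    exact dist_comm _ _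
  exact le_antisymm (key z w) (key w z)

/-- The quotient metric on `Xⁿ / Sym_n`, where `Xⁿ` carries the `ℓ²` product metric:
the distance of two multisets is the distance of the corresponding orbits. -/
instance : MetricSpace (Mult n X) where
  dist := Quotient.lift₂ (s₁ := permSetoid n X) (s₂ := permSetoid n X) orbitDist (by
    rintro z w z' w' ⟨σ, rfl⟩ ⟨τ, rfl⟩
    rw [orbitDist_comp_right, orbitDist_comm, orbitDist_comp_right, orbitDist_comm])
  dist_self := by
    rintro ⟨z⟩
    refine le_antisymm ((orbitDist_le z z 1).trans (le_of_eq ?_)) ?_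
    · exact dist_self _
    · exact Real.iInf_nonneg (fun σ => dist_nonneg)
  dist_comm := by
    rintro ⟨z⟩ ⟨w⟩
    exact orbitDist_comm z w
  dist_triangle := by
    rintro ⟨z⟩ ⟨w⟩ ⟨u⟩
    change orbitDist z u ≤ orbitDist z w + orbitDist w u
    obtain ⟨σ, hσ⟩ := exists_orbitDist_eq z w
    obtain ⟨τ, hτ⟩ := exists_orbitDist_eq w u
    rw [← hσ, ← hτ, ← tupleDist_comp w (u ∘ τ) σ]
    exact (orbitDist_le z u (τ * σ)).trans (dist_triangle _ _ _)
  eq_of_dist_eq_zero := by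
    rintro ⟨z⟩ ⟨w⟩ h
    change orbitDist z w = 0 at h
    obtain ⟨σ, hσ⟩ := exists_orbitDist_eq z w
    rw [h] at hσ
    have h' := (WithLp.toLp_injective 2) (eq_of_dist_eq_zero hσ)
    exact Quotient.sound (s := permSetoid n X) ⟨σ, h'⟩

end Metric

end Mult

/-! ### Rectangular compositions -/

/-- A matrix of nonnegative integers with at least two rows and two columns, with entry sum `n`,
and with no internal row or column that sums to zero. -/
structure IsRectComposition (n : ℕ) {h k : ℕ} (M : Matrix (Fin (h + 2)) (Fin (k + 2)) ℕ) :
    Prop where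
  row_pos : ∀ i, i ≠ 0 → i ≠ Fin.last (h + 1) → 0 < ∑ j, M i j
  col_pos : ∀ j, j ≠ 0 → j ≠ Fin.last (k + 1) → 0 < ∑ i, M i j
  sum_eq : ∑ i, ∑ j, M i j = n

/-- Rectangular compositions of `n`, of all shapes `(h + 2) × (k + 2)`. -/
structure RectComp (n : ℕ) where
  h : ℕ
  k : ℕ
  mat : Matrix (Fin (h + 2)) (Fin (k + 2)) ℕ
  isComp : IsRectComposition n mat

/-- Replace the adjacent rows `p` and `p + 1` by their sum. The map `p.predAbove` is the monotone
surjection that identifies `p` with `p + 1` and is injective otherwise. -/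
def rowMerge {h k : ℕ} (p : Fin (h + 2)) (M : Matrix (Fin (h + 3)) (Fin (k + 2)) ℕ) :
    Matrix (Fin (h + 2)) (Fin (k + 2)) ℕ :=
  fun i j => ∑ i' with p.predAbove i' = i, M i' j

/-- Replace the adjacent columns `p` and `p + 1` by their sum. -/
def colMerge {h k : ℕ} (p : Fin (k + 2)) (M : Matrix (Fin (h + 2)) (Fin (k + 3)) ℕ) :
    Matrix (Fin (h + 2)) (Fin (k + 2)) ℕ :=
  fun i j => ∑ j' with p.predAbove j' = j, M i j'

namespace RectComp

variable {n : ℕ}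

/-- `Merge b a`: the composition `a` arises from `b` by one row-merge or one column-merge.
(The merged matrix is always a composition again.) -/
inductive Merge : RectComp n → RectComp n → Prop
  | row {h k : ℕ} (p : Fin (h + 2)) (M : Matrix (Fin (h + 3)) (Fin (k + 2)) ℕ)
      (hM : IsRectComposition n M) (hN : IsRectComposition n (rowMerge p M)) :
      Merge ⟨h + 1, k, M, hM⟩ ⟨h, k, rowMerge p M, hN⟩
  | col {h k : ℕ} (p : Fin (k + 2)) (M : Matrix (Fin (h + 2)) (Fin (k + 3)) ℕ)
      (hM : IsRectComposition n M) (hN : IsRectComposition n (colMerge p M)) :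
      Merge ⟨h, k + 1, M, hM⟩ ⟨h, k, colMerge p M, hN⟩

theorem eq_or_lt_of_merges {a b : RectComp n} (hab : Relation.ReflTransGen Merge b a) :
    a = b ∨ a.h + a.k < b.h + b.k := by
  induction hab with
  | refl => exact Or.inl rfl
  | tail _ hm ih =>
    right
    cases hm <;> rcases ih with rfl | ih <;> simp only at * <;> omega

/-- `a ≤ b` if `a` arises from `b` by a finite sequence of row-merges and column-merges. -/
instance : PartialOrder (RectComp n) where
  le a b := Relation.ReflTransGen Merge b a
  le_refl _ := Relation.ReflTransGen.refl
  le_trans _ _ _ hab hbc := Relation.ReflTransGen.trans hbc hab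
  le_antisymm a b hab hba := by
    rcases eq_or_lt_of_merges hab with h | h
    · exact h
    · rcases eq_or_lt_of_merges hba with h' | h'
      · exact h'.symm
      · omega

end RectComp

/-! ### Piecewise Euclidean cell complexes -/

/-- A piecewise Euclidean cell complex: a quotient of a disjoint union of convex polytopes in
Euclidean spaces that is injective on the relative interior of every face, and such that, whenever
two points in the relative interiors of two faces are identified, these whole faces are identified
through an isometry. Faces are the nonempty exposed faces. -/
structure EuclideanComplex where
  ι : Type
  dim : ι → ℕ
  cell : ∀ i, Set (EuclideanSpace ℝ (Fin (dim i)))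
  polytope : ∀ i, ∃ s : Finset (EuclideanSpace ℝ (Fin (dim i))),
    s.Nonempty ∧ cell i = convexHull ℝ (s : Set (EuclideanSpace ℝ (Fin (dim i))))
  rel : Setoid (Σ i, cell i)
  inj : ∀ (i : ι) (F : Set (EuclideanSpace ℝ (Fin (dim i)))), IsExposed ℝ (cell i) F →
    ∀ u v : cell i, (u : EuclideanSpace ℝ (Fin (dim i))) ∈ intrinsicInterior ℝ F →
      (v : EuclideanSpace ℝ (Fin (dim i))) ∈ intrinsicInterior ℝ F →
      rel ⟨i, u⟩ ⟨i, v⟩ → u = v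
  glue : ∀ (i j : ι) (F : Set (EuclideanSpace ℝ (Fin (dim i))))
    (G : Set (EuclideanSpace ℝ (Fin (dim j))))
    (hF : IsExposed ℝ (cell i) F) (hG : IsExposed ℝ (cell j) G) (u : cell i) (v : cell j),
    (u : EuclideanSpace ℝ (Fin (dim i))) ∈ intrinsicInterior ℝ F →
    (v : EuclideanSpace ℝ (Fin (dim j))) ∈ intrinsicInterior ℝ G →
    rel ⟨i, u⟩ ⟨j, v⟩ →
    ∃ g : F ≃ᵢ G, ∀ y : F, rel ⟨i, ⟨y, hF.subset y.2⟩⟩ ⟨j, ⟨g y, hG.subset (g y).2⟩⟩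

namespace EuclideanComplex

variable (K : EuclideanComplex)

/-- The underlying set of the complex. -/
def Space : Type := Quotient K.rel

/-- The point of the complex given by a point of one of the polytopes. -/
def pt (i : K.ι) (u : K.cell i) : K.Space := Quotient.mk K.rel ⟨i, u⟩

/-- `K.StringLength x y L`: there is a finite string of points from `x` to `y`, consecutive points
lying in a common polytope, with total length `L`. -/
inductive StringLength : K.Space → K.Space → ℝ≥0∞ → Prop
  | refl (x : K.Space) : StringLength x x 0
  | step (i : K.ι) (u v : K.cell i) {y : K.Space} {L : ℝ≥0∞} :
      StringLength (K.pt i v) y L → StringLength (K.pt i u) y (edist u v + L)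

variable {K}

theorem StringLength.trans {x y z : K.Space} {L M : ℝ≥0∞} (h : K.StringLength x y L)
    (h' : K.StringLength y z M) : K.StringLength x z (L + M) := by
  induction h with
  | refl => simpa using h'
  | step i u v _ ih =>
    rw [add_assoc]
    exact StringLength.step i u v (ih h')

theorem StringLength.symm {x y : K.Space} {L : ℝ≥0∞} (h : K.StringLength x y L) :
    K.StringLength y x L := by
  induction h with
  | refl x => exact StringLength.refl x
  | step i u v _ ih =>
    have h1 := StringLength.step i v u (StringLength.refl (K.pt i u))
    rw [add_comm]
    simpa [edist_comm] using ih.trans h1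

/-- The intrinsic distance of a piecewise Euclidean complex: the infimum of the lengths of
strings (infinite if there are none). -/
instance : PseudoEMetricSpace K.Space where
  edist x y := ⨅ (L : ℝ≥0∞) (_ : K.StringLength x y L), L
  edist_self x := le_antisymm (iInf₂_le 0 (StringLength.refl x)) bot_le
  edist_comm x y := le_antisymm
    (le_iInf₂ fun L hL => iInf₂_le L hL.symm) (le_iInf₂ fun L hL => iInf₂_le L hL.symm)
  edist_triangle x y z := by
    simp only [ENNReal.iInf_add, ENNReal.add_iInf]
    refine le_iInf₂ fun L hL => le_iInf₂ fun M hM => ?_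
    exact iInf₂_le _ (StringLength.trans hM hL)

variable (K)

/-- `F` is a nonempty face of the polytope with index `i`. -/
def IsFace (i : K.ι) (F : Set (EuclideanSpace ℝ (Fin (K.dim i)))) : Prop :=
  IsExposed ℝ (K.cell i) F ∧ F.Nonempty

/-- The image in the complex of a subset of a polytope. -/
def image (i : K.ι) (F : Set (EuclideanSpace ℝ (Fin (K.dim i)))) : Set K.Space :=
  K.pt i '' {u | (u : EuclideanSpace ℝ (Fin (K.dim i))) ∈ F}

/-- The (closed) cells of the complex: the images of the nonempty faces of the polytopes. -/
def IsCell (S : Set K.Space) : Prop := ∃ i F, K.IsFace i F ∧ S = K.image i F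

/-- The face poset: all nonempty cells, ordered by inclusion. -/
abbrev FacePoset : Type := {S : Set K.Space // K.IsCell S}

variable {K}

/-- The cell of the complex given by a face of a polytope. -/
def IsFace.toCell {i : K.ι} {F : Set (EuclideanSpace ℝ (Fin (K.dim i)))} (hF : K.IsFace i F) :
    K.FacePoset :=
  ⟨K.image i F, i, F, hF, rfl⟩

end EuclideanComplex

/-! ### Orthoschemes -/

/-- A `d`-dimensional orthoscheme: the convex hull of the points
`p₀, p₀ + v₁, …, p₀ + v₁ + ⋯ + v_d`, with nonzero pairwise orthogonal vectors `v₁, …, v_d`. -/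
def IsOrthoscheme {E : Type*} [NormedAddCommGroup E] [InnerProductSpace ℝ E] (d : ℕ)
    (S : Set E) : Prop :=
  ∃ (p : E) (v : Fin d → E), (∀ i, v i ≠ 0) ∧ (∀ i j, i ≠ j → inner ℝ (v i) (v j) = 0) ∧
    S = convexHull ℝ (Set.range fun m : Fin (d + 1) => p + ∑ i with i.castSucc < m, v i)

/-- A metric space is a bi-orthoscheme if it is isometric to the (Euclidean, `ℓ²`) product of two
orthoschemes. -/
def IsBiOrthoscheme (S : Type*) [PseudoEMetricSpace S] : Prop :=
  ∃ (d e : ℕ) (A : Set (EuclideanSpace ℝ (Fin d))) (B : Set (EuclideanSpace ℝ (Fin e))),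
    IsOrthoscheme d A ∧ IsOrthoscheme e B ∧
    Nonempty (S ≃ᵢ {w : WithLp 2 (EuclideanSpace ℝ (Fin d) × EuclideanSpace ℝ (Fin e)) |
      w.fst ∈ A ∧ w.snd ∈ B})

/-! ### Multiplicity matrices -/

/-- The rectangular composition `a` is the multiplicity matrix of the multiset `z` in the coordinate
rectangle `[xl, xr] + i [yb, yt]`: for some `xl = x 0 < x 1 < ⋯ < x (h + 1) = xr` and
`yb = y 0 < y 1 < ⋯ < y (k + 1) = yt`, the entry `a i j` is the multiplicity of the point
`(x i, y j)` in `z`. As the entries of `a` sum to `n`, all the points of `z` are counted, and as no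
internal row or column of `a` is zero, each internal `x i` is the real part and each internal `y j`
the imaginary part of a point of `z`. -/
def IsMultiplicityMatrix {n : ℕ} (xl xr yb yt : ℝ)
    (z : Mult n (Set.Icc xl xr ×ℂ Set.Icc yb yt : Set ℂ)) (a : RectComp n) : Prop :=
  ∃ (x : Fin (a.h + 2) → ℝ) (y : Fin (a.k + 2) → ℝ),
    StrictMono x ∧ x 0 = xl ∧ x (Fin.last _) = xr ∧
    StrictMono y ∧ y 0 = yb ∧ y (Fin.last _) = yt ∧
    ∀ i j, (z.map Subtype.val).count (⟨x i, y j⟩ : ℂ) = a.mat i j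

end

/-! A multiset in the rectangle is given by a sorted tuple of real parts, a sorted tuple of
imaginary parts, and a permutation `σ` matching them. So take one copy of the polytope `sortedCell`,
a product of two simplices of sorted tuples, for each `σ`, send `(x, y)` to the multiset of the
points with real part `x t` and imaginary part `y (σ t)` (`cellMap`), and divide by the fibres of
these maps. Sorting is unique, so identified points have the same coordinates (`eq_of_cellMap_eq`).
If two copies agree at `u`, they agree on the whole face around `u`, because every equality among
the coordinates of `u` persists there (`cellMap_eq_of_mem_sortedFace`). Hence all gluings are
identities.

Isometry: the maps `cellMap σ` do not increase distances. Conversely, an optimal matching of two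
multisets gives a straight segment of tuples. Cut it where two real parts or two imaginary parts
cross: each piece then lies in one polytope, and the lengths add up (`edist_le_ofReal_pairDist`).

Faces: the face around `u` consists of the sorted pairs keeping the equalities among the coordinates
of `u` and the endpoints. Creating further equalities amounts to applying monotone surjections to
the row and column indices of the composition, and these are the composites of merges
(`RectComp.le_iff`). So the image of the face is the set of multisets whose composition is at most
that of `u` (`exists_collapse_iff`), and its relative interior gives equality. A value repeated `m`
times contributes `m` equal squares to the distance; weighting it by `√m` turns each factor of the
face into an orthoscheme (`exists_orthoscheme_face`). -/

section Polyhedron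

/-! ### Faces of polyhedra and their relative interiors, in terms of tight inequalities. -/

variable {E κ : Type*} [NormedAddCommGroup E] [NormedSpace ℝ E]

/-- The line through `y` and `u` stays in the affine span of `F`, where `u` is an interior point, so
the segment from `y` can be prolonged beyond `u`. -/
theorem exists_add_smul_sub_mem_of_mem_intrinsicInterior {F : Set E} {u y : E}
    (hu : u ∈ intrinsicInterior ℝ F) (hy : y ∈ F) : ∃ ε : ℝ, 0 < ε ∧ u + ε • (u - y) ∈ F := by
  obtain ⟨u', hu', rfl⟩ := mem_intrinsicInterior.1 hu
  have hmem : ∀ t : ℝ, (u' : E) + t • ((u' : E) - y) ∈ affineSpan ℝ F := fun t => by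
    have := AffineMap.lineMap_mem (1 + t) (subset_affineSpan ℝ F hy) u'.2
    convert this using 1
    simp only [AffineMap.lineMap_apply, vsub_eq_sub, vadd_eq_add]
    module
  let γ : ℝ → affineSpan ℝ F := fun t => ⟨(u' : E) + t • ((u' : E) - y), hmem t⟩
  have hγ : Continuous γ := by
    apply Continuous.subtype_mk
    fun_prop
  have h0 : γ 0 = u' := by ext; simp [γ]
  have hev : ∀ᶠ t in nhds (0 : ℝ), γ t ∈ interior ((↑) ⁻¹' F : Set (affineSpan ℝ F)) :=
    hγ.continuousAt.eventually (by rw [h0]; exact isOpen_interior.mem_nhds hu')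
  have hev' := (hev.filter_mono (nhdsWithin_le_nhds (s := Set.Ioi 0))).and self_mem_nhdsWithin
  obtain ⟨ε, h1, h2⟩ := hev'.exists
  have h3 := interior_subset h1
  exact ⟨ε, h2, h3⟩

/-- The polyhedron defined by the inequalities `c k ≤ L k x`. -/
def polyhedron (L : κ → E →L[ℝ] ℝ) (c : κ → ℝ) : Set E := {x | ∀ k, c k ≤ L k x}

/-- The points of a polyhedron at which all the inequalities tight at `u` are tight. -/
def tightFace (L : κ → E →L[ℝ] ℝ) (c : κ → ℝ) (u : E) : Set E :=
  {y | y ∈ polyhedron L c ∧ ∀ k, L k u = c k → L k y = c k}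

variable {L : κ → E →L[ℝ] ℝ} {c : κ → ℝ}

theorem mem_tightFace_self {u : E} (hu : u ∈ polyhedron L c) : u ∈ tightFace L c u :=
  ⟨hu, fun _ h => h⟩

theorem isExposed_tightFace [Finite κ] {u : E} (hu : u ∈ polyhedron L c) :
    IsExposed ℝ (polyhedron L c) (tightFace L c u) := by
  classical
  have := Fintype.ofFinite κ
  intro _
  -- The sum of the functionals tight at `u` is minimal exactly where each of them attains its
  -- bound; the sign turns this into a maximum.
  refine ⟨-∑ k with L k u = c k, L k, ?_⟩
  ext y
  simp only [tightFace, Set.mem_ofPred_eq, neg_apply,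
    sum_apply, neg_le_neg_iff]
  refine and_congr_right fun hy => ⟨fun h w hw => ?_, fun h k hk => ?_⟩
  · refine Finset.sum_le_sum fun k hk => ?_
    rw [h k (Finset.mem_filter.1 hk).2]
    exact hw k
  · have h1 := h u hu
    have h2 : ∀ k ∈ Finset.univ.filter (fun k => L k u = c k), L k u ≤ L k y := fun k hk => by
      rw [(Finset.mem_filter.1 hk).2]
      exact hy k
    have h3 := (Finset.sum_eq_sum_iff_of_le h2).1 (le_antisymm (Finset.sum_le_sum h2) h1)
    rw [← h3 k (by simpa using hk), hk]

/-- An inequality tight at `u` but slack at `y` would be violated just beyond `u` on the line from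
`y`. -/
theorem subset_tightFace {F : Set E} (hF : F ⊆ polyhedron L c) {u : E}
    (hu : u ∈ intrinsicInterior ℝ F) : F ⊆ tightFace L c u := by
  intro y hy
  refine ⟨hF hy, fun k hk => ?_⟩
  obtain ⟨ε, hε, h⟩ := exists_add_smul_sub_mem_of_mem_intrinsicInterior hu hy
  have h1 := hF h k
  have h2 := hF hy k
  simp only [map_add, map_smul, map_sub, smul_eq_mul, hk] at h1
  by_contra hne
  have : 0 < L k y - c k := sub_pos.2 (lt_of_le_of_ne h2 (Ne.symm hne))
  nlinarith

/-- The tight inequalities remain equalities along the line; the finitely many slack ones survive a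
small step by continuity. -/
theorem exists_add_smul_sub_mem_polyhedron [Finite κ] {u y : E} (hu : u ∈ polyhedron L c)
    (hy : y ∈ tightFace L c u) : ∃ ε : ℝ, 0 < ε ∧ u + ε • (u - y) ∈ polyhedron L c := by
  have key : ∀ k, ∀ᶠ ε in nhdsWithin (0 : ℝ) (Set.Ioi 0), c k ≤ L k (u + ε • (u - y)) := by
    intro k
    by_cases hk : L k u = c k
    · refine Filter.Eventually.of_forall fun ε => ?_
      simp [hk, hy.2 k hk]
    · have hlt : c k < L k u := lt_of_le_of_ne (hu k) (Ne.symm hk)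
      have hc : Continuous fun ε : ℝ => L k (u + ε • (u - y)) := by fun_prop
      refine Filter.Eventually.filter_mono nhdsWithin_le_nhds ?_
      exact (hc.continuousAt.eventually (lt_mem_nhds (by simpa using hlt))).mono fun _ h => h.le
  obtain ⟨ε, h1, h2⟩ := ((Filter.eventually_all.2 key).and self_mem_nhdsWithin).exists
  exact ⟨ε, h2, h1⟩

theorem eq_tightFace_of_mem_intrinsicInterior [Finite κ] {F : Set E}
    (hF : IsExposed ℝ (polyhedron L c) F) {u : E} (hu : u ∈ intrinsicInterior ℝ F) :
    F = tightFace L c u := by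
  refine (subset_tightFace hF.subset hu).antisymm fun y hy => ?_
  have huF := intrinsicInterior_subset hu
  obtain ⟨ε, hε, h⟩ := exists_add_smul_sub_mem_polyhedron (hF.subset huF) hy
  -- `u` lies strictly between `y` and the prolonged point, so extremality of `F` forces `y ∈ F`.
  refine hF.isExtreme.left_mem_of_mem_openSegment hy.1 h huF ?_
  refine ⟨ε / (1 + ε), 1 / (1 + ε), by positivity, by positivity, by field_simp; ring, ?_⟩
  have h1 : (1 + ε) ≠ 0 := by positivity
  rw [smul_add, smul_smul, smul_sub]
  have : u = ((1 + ε) / (1 + ε)) • u := by rw [div_self h1, one_smul]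
  conv_rhs => rw [this]
  module

/-- The right-hand side says that `u` and `v` have the same tight inequalities. These hold with
equality on the whole affine span of the face, and the others are strict at `v`, hence valid near
it. -/
theorem mem_intrinsicInterior_tightFace_iff [Finite κ] {u v : E} (hu : u ∈ polyhedron L c) :
    v ∈ intrinsicInterior ℝ (tightFace L c u) ↔ v ∈ tightFace L c u ∧ u ∈ tightFace L c v := by
  constructor
  · intro hv
    refine ⟨intrinsicInterior_subset hv, ?_⟩
    rw [← eq_tightFace_of_mem_intrinsicInterior (isExposed_tightFace hu) hv]
    exact mem_tightFace_self hu
  · rintro ⟨hv, hv'⟩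
    have hspan : ∀ y ∈ affineSpan ℝ (tightFace L c u), ∀ k, L k u = c k → L k y = c k := by
      intro y hy k hk
      refine affineSpan_induction (p := fun y => L k y = c k) hy (fun y hy => hy.2 k hk) ?_
      intro t p q r hp hq hr
      simp [hp, hq, hr]
    refine mem_intrinsicInterior.2 ⟨⟨v, subset_affineSpan ℝ _ hv⟩, ?_, rfl⟩
    rw [mem_interior_iff_mem_nhds]
    have key : ∀ k, ∀ᶠ y : affineSpan ℝ (tightFace L c u) in
        nhds ⟨v, subset_affineSpan ℝ _ hv⟩, c k ≤ L k y := by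
      intro k
      by_cases hk : L k v = c k
      · exact Filter.Eventually.of_forall fun y => (hspan y y.2 k (hv'.2 k hk)).ge
      · have hlt : c k < L k v := lt_of_le_of_ne (hv.1 k) (Ne.symm hk)
        have hc : Continuous fun y : affineSpan ℝ (tightFace L c u) => L k y := by fun_prop
        exact (hc.continuousAt.eventually (lt_mem_nhds hlt)).mono fun _ h => h.le
    filter_upwards [Filter.eventually_all.2 key] with y hy
    exact ⟨hy, hspan y y.2⟩

theorem IsExposed.exists_eq_tightFace [Finite κ] [FiniteDimensional ℝ E] {F : Set E}
    (hF : IsExposed ℝ (polyhedron L c) F) (hne : F.Nonempty) :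
    ∃ u ∈ polyhedron L c, F = tightFace L c u := by
  have hP : Convex ℝ (polyhedron L c) := by
    have : polyhedron L c = ⋂ k, {x | c k ≤ L k x} := by ext; simp [polyhedron]
    rw [this]
    exact convex_iInter fun k => convex_halfSpace_ge (L k).isLinear _
  obtain ⟨u, hu⟩ := hne.intrinsicInterior (hF.convex hP)
  exact ⟨u, hF.subset (intrinsicInterior_subset hu), eq_tightFace_of_mem_intrinsicInterior hF hu⟩

end Polyhedron

/-! ### Tuples padded by the endpoints, which turns order and bounds into a single monotonicity
condition. -/

section PadEnds

/-- The tuple `(a, x 0, …, x (n - 1), b)`. -/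
def padEnds (a b : ℝ) {n : ℕ} (x : Fin n → ℝ) : Fin (n + 2) → ℝ :=
  Fin.cons a (Fin.snoc x b : Fin (n + 1) → ℝ)

variable {a b : ℝ} {n : ℕ}

@[simp] theorem padEnds_zero (x : Fin n → ℝ) : padEnds a b x 0 = a := rfl

@[simp] theorem padEnds_last (x : Fin n → ℝ) : padEnds a b x (Fin.last (n + 1)) = b := by
  rw [← Fin.succ_last, padEnds, Fin.cons_succ, Fin.snoc_last]

@[simp] theorem padEnds_inner (x : Fin n → ℝ) (i : Fin n) :
    padEnds a b x i.castSucc.succ = x i := by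
  rw [padEnds, Fin.cons_succ, Fin.snoc_castSucc]

theorem forall_fin_padEnds {p : Fin (n + 2) → Prop} (h0 : p 0) (hl : p (Fin.last (n + 1)))
    (hi : ∀ i : Fin n, p i.castSucc.succ) (i : Fin (n + 2)) : p i := by
  refine Fin.cases h0 (fun j => ?_) i
  refine Fin.lastCases ?_ (fun k => hi k) j
  rwa [Fin.succ_last]

theorem eq_padEnds {X : Fin (n + 2) → ℝ} (h0 : X 0 = a) (hl : X (Fin.last (n + 1)) = b) :
    padEnds a b (fun i => X i.castSucc.succ) = X := by
  funext i
  exact forall_fin_padEnds (p := fun i => padEnds a b (fun i => X i.castSucc.succ) i = X i)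
    (by simp [h0]) (by simp [hl]) (by simp) i

theorem monotone_padEnds_mem {x : Fin n → ℝ} (h : Monotone (padEnds a b x)) (i : Fin n) :
    x i ∈ Set.Icc a b := by
  have h1 := h (Fin.zero_le i.castSucc.succ)
  have h2 := h (Fin.le_last i.castSucc.succ)
  simp only [padEnds_zero, padEnds_last, padEnds_inner] at h1 h2
  exact ⟨h1, h2⟩

theorem monotone_of_monotone_padEnds {x : Fin n → ℝ} (h : Monotone (padEnds a b x)) :
    Monotone x := by
  intro i j hij
  have := h (show i.castSucc.succ ≤ j.castSucc.succ by simpa using hij)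
  simpa using this

theorem monotone_padEnds (hab : a ≤ b) {x : Fin n → ℝ} (hx : Monotone x)
    (hmem : ∀ i, x i ∈ Set.Icc a b) : Monotone (padEnds a b x) := by
  intro i
  refine forall_fin_padEnds (p := fun i => ∀ j, i ≤ j → padEnds a b x i ≤ padEnds a b x j)
    ?_ ?_ ?_ i
  · refine forall_fin_padEnds ?_ ?_ ?_
    · simp
    · simpa using hab
    · intro j _
      simpa using (hmem j).1
  · intro j hj
    rw [le_antisymm (Fin.le_last j) hj]
  · intro i
    refine forall_fin_padEnds ?_ ?_ ?_
    · intro h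
      exact absurd h (by simp)
    · intro _
      simpa using (hmem i).2
    · intro j hij
      simpa using hx (by simpa using hij)

theorem padEnds_add_smul (x y : Fin n → ℝ) {s t : ℝ} (hst : s + t = 1) :
    padEnds a b (s • x + t • y) = s • padEnds a b x + t • padEnds a b y := by
  funext i
  refine forall_fin_padEnds (p := fun i => padEnds a b (s • x + t • y) i =
    (s • padEnds a b x + t • padEnds a b y) i) ?_ ?_ ?_ i
  · simp [← add_mul, hst]
  · simp [← add_mul, hst]
  · simp

theorem convex_monotone_padEnds : Convex ℝ {x : Fin n → ℝ | Monotone (padEnds a b x)} := by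
  intro x hx y hy s t hs ht hst i j hij
  have h1 := hx hij
  have h2 := hy hij
  rw [padEnds_add_smul x y hst]
  simp only [Pi.add_apply, Pi.smul_apply, smul_eq_mul]
  gcongr

end PadEnds

/-! ### The simplex of sorted tuples as an orthoscheme. -/

section Orthoscheme

variable {a b : ℝ} {d : ℕ}

/-- The tuple with `m` entries `a` followed by entries `b`. -/
def stepTuple (a b : ℝ) {d : ℕ} (m : Fin (d + 1)) : Fin d → ℝ :=
  fun i => if i.castSucc < m then a else b

theorem monotone_padEnds_stepTuple (hab : a ≤ b) (m : Fin (d + 1)) :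
    Monotone (padEnds a b (stepTuple a b m)) := by
  refine monotone_padEnds hab ?_ ?_
  · intro i j hij
    unfold stepTuple
    split_ifs with h1 h2
    · exact le_rfl
    · exact hab
    · exact absurd (lt_of_le_of_lt (Fin.castSucc_le_castSucc_iff.2 hij) (by assumption)) h1
    · exact le_rfl
  · intro i
    unfold stepTuple
    split_ifs
    · exact ⟨le_rfl, hab⟩
    · exact ⟨hab, le_rfl⟩

/-- The monotone tuples with entries in `[a, b]` form a simplex. -/
theorem convexHull_range_stepTuple (hab : a < b) :
    convexHull ℝ (Set.range (stepTuple a b : Fin (d + 1) → Fin d → ℝ)) =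
      {x | Monotone (padEnds a b x)} := by
  apply Set.Subset.antisymm
  · refine convexHull_min ?_ convex_monotone_padEnds
    rintro _ ⟨m, rfl⟩
    exact monotone_padEnds_stepTuple hab.le m
  · intro x hx
    have hx : Monotone (padEnds a b x) := hx
    have hab' : 0 < b - a := sub_pos.2 hab
    set X := padEnds a b x with hX
    -- The barycentric coordinates are the normalized gaps of the padded tuple.
    let w : Fin (d + 1) → ℝ := fun m => (X m.succ - X m.castSucc) / (b - a)
    have hw0 : ∀ m, 0 ≤ w m := fun m =>
      div_nonneg (sub_nonneg.2 (hx (Fin.castSucc_le_succ m))) hab'.le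
    -- `X` extended to `ℕ`, with an irrelevant default value, so that sums of gaps telescope over
    -- `Finset.range`.
    let T : ℕ → ℝ := fun k => if h : k < d + 2 then X ⟨k, h⟩ else 0
    have hT : ∀ k : Fin (d + 2), T k = X k := fun k => by simp [T]
    have hw : ∀ m : Fin (d + 1), w m = (T (m + 1) - T m) / (b - a) := fun m => by
      have h1 := hT m.succ
      have h2 := hT m.castSucc
      simp only [Fin.val_succ, Fin.val_castSucc] at h1 h2
      rw [h1, h2]
    have hT0 : T 0 = a := by simpa [hX] using hT 0
    have hTl : T (d + 1) = b := by simpa [hX] using hT (Fin.last (d + 1))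
    have hsum : ∑ m, w m = 1 := by
      simp only [hw]
      rw [Fin.sum_univ_eq_sum_range (fun m => (T (m + 1) - T m) / (b - a)), ← Finset.sum_div,
        Finset.sum_range_sub, hT0, hTl, div_self hab'.ne']
    have hcomb : ∑ m, w m • (stepTuple a b m : Fin d → ℝ) = x := by
      funext i
      have h1 : ∀ m : Fin (d + 1), w m * stepTuple a b m i =
          w m * a + (if (m : ℕ) < i + 1 then T (m + 1) - T m else 0) := by
        intro m
        unfold stepTuple
        by_cases h : i.castSucc < m
        · have h' : ¬ (m : ℕ) < i + 1 := by
            rw [Fin.lt_def] at h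
            simp only [Fin.val_castSucc] at h
            omega
          simp [h, h']
        · have h' : (m : ℕ) < i + 1 := by
            rw [Fin.lt_def] at h
            simp only [Fin.val_castSucc] at h
            omega
          simp only [h, h', if_true, if_false]
          rw [hw]
          field_simp
          ring
      have h2 : Finset.filter (fun m => m < (i : ℕ) + 1) (Finset.range (d + 1)) =
          Finset.range (i + 1) := by
        ext m
        simp only [Finset.mem_filter, Finset.mem_range]
        have := i.2
        omega
      rw [Finset.sum_apply]
      simp only [Pi.smul_apply, smul_eq_mul, h1, Finset.sum_add_distrib]
      rw [← Finset.sum_mul, hsum, Fin.sum_univ_eq_sum_range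
        (fun m => if m < (i : ℕ) + 1 then T (m + 1) - T m else 0), ← Finset.sum_filter, h2,
        Finset.sum_range_sub, hT0]
      have h3 := hT i.castSucc.succ
      simp only [Fin.val_succ, Fin.val_castSucc] at h3
      rw [h3, hX, padEnds_inner]
      ring
    rw [← hcomb]
    exact (convex_convexHull ℝ _).sum_mem (fun m _ => hw0 m) hsum
      (fun m _ => subset_convexHull ℝ _ ⟨m, rfl⟩)

/-- Scaling the coordinates of a tuple. -/
def scaleTuple (w : Fin d → ℝ) : (Fin d → ℝ) →ₗ[ℝ] EuclideanSpace ℝ (Fin d) where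
  toFun x := WithLp.toLp 2 (fun i => w i * x i)
  map_add' x y := by ext i; simp [mul_add]
  map_smul' t x := by ext i; simp; ring

@[simp] theorem scaleTuple_apply (w x : Fin d → ℝ) (i : Fin d) :
    scaleTuple w x i = w i * x i := rfl

/-- Consecutive vertices `stepTuple a b m` differ in one entry, which changes from `b` to `a`. The
edges are therefore multiples of distinct basis vectors, and this survives scaling the coordinates.
-/
theorem isOrthoscheme_image_scaleTuple (hab : a < b) {w : Fin d → ℝ} (hw : ∀ i, w i ≠ 0) :
    IsOrthoscheme d (scaleTuple w '' {x | Monotone (padEnds a b x)}) := by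
  refine ⟨scaleTuple w (fun _ => b), fun i => EuclideanSpace.single i (w i * (a - b)), ?_, ?_, ?_⟩
  · intro i h
    have := congrArg (fun v : EuclideanSpace ℝ (Fin d) => v i) h
    simp [hw i, sub_eq_zero, hab.ne] at this
  · intro i j hij
    simp [EuclideanSpace.inner_single_left, hij]
  · rw [← convexHull_range_stepTuple hab, LinearMap.image_convexHull, ← Set.range_comp]
    congr 2
    funext m
    ext j
    simp only [Function.comp, scaleTuple_apply, PiLp.add_apply, WithLp.ofLp_sum, Finset.sum_apply,
      PiLp.single_apply, stepTuple]
    by_cases h : j.castSucc < m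
    · rw [Finset.sum_eq_single j]
      · simp [h]; ring
      · intro i _ hij
        simp [hij.symm]
      · simp [h]
    · rw [Finset.sum_eq_zero]
      · simp [h]
      · intro i hi
        have : j ≠ i := by rintro rfl; exact h (Finset.mem_filter.1 hi).2
        simp [this]

end Orthoscheme

/-! ### Monotone surjections between finite chains. -/

section MonotoneSurjection

theorem Fin.map_zero_of_monotone_surjective {p q : ℕ} {ρ : Fin (p + 1) → Fin (q + 1)}
    (hm : Monotone ρ) (hs : Function.Surjective ρ) : ρ 0 = 0 := by
  obtain ⟨i, hi⟩ := hs 0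
  exact le_antisymm (hi ▸ hm (Fin.zero_le i)) (Fin.zero_le _)

theorem Fin.map_last_of_monotone_surjective {p q : ℕ} {ρ : Fin (p + 1) → Fin (q + 1)}
    (hm : Monotone ρ) (hs : Function.Surjective ρ) : ρ (Fin.last p) = Fin.last q := by
  obtain ⟨i, hi⟩ := hs (Fin.last q)
  exact le_antisymm (Fin.le_last _) (hi ▸ hm (Fin.le_last i))

theorem Fin.eq_id_of_monotone_surjective {p : ℕ} {ρ : Fin p → Fin p}
    (hm : Monotone ρ) (hs : Function.Surjective ρ) : ρ = id := by
  have hinj : Function.Injective ρ := Finite.injective_iff_surjective.2 hs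
  have hr : Set.range ρ = Set.range (id : Fin p → Fin p) := by rw [hs.range_eq]; simp
  exact ((hm.strictMono_of_injective hinj).range_inj strictMono_id).1 hr

/-- A monotone surjection onto a shorter chain factors through the merging of two neighbours. -/
theorem Fin.exists_eq_comp_predAbove {p q : ℕ} {ρ : Fin (p + 1) → Fin q} (hm : Monotone ρ)
    (hs : Function.Surjective ρ) (hq : q ≤ p) :
    ∃ (i : Fin p) (ρ' : Fin p → Fin q), Monotone ρ' ∧ Function.Surjective ρ' ∧
      ρ = ρ' ∘ i.predAbove := by
  have hex : ∃ i : Fin p, ρ i.castSucc = ρ i.succ := by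
    by_contra! hne
    have hmono : StrictMono ρ := Fin.strictMono_iff_lt_succ.2 fun i =>
      lt_of_le_of_ne (hm (Fin.castSucc_le_succ i)) (hne i)
    have := Fintype.card_le_of_injective ρ hmono.injective
    simp at this
    omega
  obtain ⟨i, hi⟩ := hex
  -- `i.succ.succAbove` is a section of `i.predAbove` that misses only `i.succ`, where `ρ` has the
  -- same value as at `i.castSucc`.
  have heq : ρ = (ρ ∘ i.succ.succAbove) ∘ i.predAbove := by
    funext j
    rcases lt_trichotomy j i.succ with h | h | h
    · have h' : j ≤ i.castSucc := by
        rw [Fin.lt_def] at h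
        rw [Fin.le_def]
        simp only [Fin.val_succ, Fin.val_castSucc] at *
        omega
      have h1 : i.predAbove j = j.castPred (by
          rintro rfl
          have := i.2
          rw [Fin.le_def] at h'
          simp at h'
          omega) :=
        Fin.predAbove_of_le_castSucc _ _ h'
      simp only [Function.comp, h1]
      rw [Fin.succAbove_of_castSucc_lt _ _ (by simpa using h)]
      simp
    · subst h
      have h1 : i.predAbove i.succ = i := by simp
      simp only [Function.comp, h1]
      rw [Fin.succAbove_of_castSucc_lt _ _ (Fin.castSucc_lt_succ), hi]
    · have h1 : i.castSucc < j := lt_trans Fin.castSucc_lt_succ h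
      simp only [Function.comp]
      rw [Fin.predAbove_of_castSucc_lt _ _ h1, Fin.succAbove_of_le_castSucc]
      · simp
      · rw [Fin.lt_def] at h
        rw [Fin.le_def]
        simp only [Fin.val_succ, Fin.val_castSucc, Fin.val_pred] at *
        omega
  refine ⟨i, _, hm.comp (Fin.strictMono_succAbove _).monotone, ?_, heq⟩
  intro y
  obtain ⟨x, hx⟩ := hs y
  exact ⟨i.predAbove x, by rw [← hx]; exact (congrFun heq x).symm⟩

/-- A monotone tuple is a strictly monotone tuple with repetitions. -/
theorem exists_strictMono_comp {n : ℕ} {X : Fin (n + 2) → ℝ} (hX : Monotone X)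
    (h01 : X 0 < X (Fin.last (n + 1))) :
    ∃ (h : ℕ) (x : Fin (h + 2) → ℝ) (r : Fin (n + 2) → Fin (h + 2)),
      StrictMono x ∧ Monotone r ∧ Function.Surjective r ∧ X = x ∘ r := by
  classical
  set s := Finset.univ.image X with hs
  have hmem : ∀ i, X i ∈ s := fun i => Finset.mem_image_of_mem _ (Finset.mem_univ i)
  have hcard : 1 < s.card := Finset.one_lt_card.2 ⟨_, hmem 0, _, hmem _, h01.ne⟩
  obtain ⟨h, hh⟩ : ∃ h, s.card = h + 2 := ⟨s.card - 2, by omega⟩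
  have hsm : StrictMono (s.orderEmbOfFin hh) := (s.orderEmbOfFin hh).strictMono
  have hex : ∀ i, ∃ j, s.orderEmbOfFin hh j = X i := fun i => by
    have : X i ∈ Set.range (s.orderEmbOfFin hh) := by
      rw [Finset.range_orderEmbOfFin]
      exact hmem i
    exact this
  choose r hr using hex
  refine ⟨h, s.orderEmbOfFin hh, r, hsm, ?_, ?_, ?_⟩
  · intro i j hij
    rw [← hsm.le_iff_le, hr, hr]
    exact hX hij
  · intro j
    obtain ⟨i, -, hi⟩ := Finset.mem_image.1 (Finset.orderEmbOfFin_mem s hh j)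
    exact ⟨i, hsm.injective (by rw [hr, hi])⟩
  · funext i
    exact (hr i).symm

/-- Compose `r'` with a section of `r`. The section need not be monotone, but where it reverses `i ≤
j`, monotonicity of `r` forces `i = j`. -/
theorem exists_monotone_surjective_comp {α : Type*} [LinearOrder α] {p q : ℕ} {r : α → Fin p}
    {r' : α → Fin q} (hr : Monotone r) (hrs : Function.Surjective r) (hr' : Monotone r')
    (hrs' : Function.Surjective r') (hf : Function.FactorsThrough r' r) :
    ∃ ρ : Fin p → Fin q, Monotone ρ ∧ Function.Surjective ρ ∧ r' = ρ ∘ r := by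
  choose g hg using hrs
  have heq : r' = (r' ∘ g) ∘ r := by
    funext i
    exact hf (hg (r i)).symm
  refine ⟨r' ∘ g, ?_, ?_, heq⟩
  · intro i j hij
    rcases le_total (g i) (g j) with h | h
    · exact hr' h
    · have h1 := hr h
      rw [hg, hg] at h1
      rw [le_antisymm hij h1]
  · intro y
    obtain ⟨x, hx⟩ := hrs' y
    exact ⟨r x, by rw [← hx]; exact (congrFun heq x).symm⟩

end MonotoneSurjection

/-! ### Compositions as count matrices, and merges as monotone surjections of the indices. -/

section CountMatrix

variable {n p q : ℕ}

/-- The matrix whose `(i, j)` entry is the number of `t` with `r t = i` and `s t = j`. -/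
def countMatrix (r : Fin n → Fin p) (s : Fin n → Fin q) : Matrix (Fin p) (Fin q) ℕ :=
  fun i j => (Finset.univ.filter fun t => r t = i ∧ s t = j).card

theorem sum_countMatrix_row (r : Fin n → Fin p) (s : Fin n → Fin q) (i : Fin p) :
    ∑ j, countMatrix r s i j = (Finset.univ.filter fun t => r t = i).card := by
  rw [Finset.card_eq_sum_card_fiberwise (f := s) (t := Finset.univ) (by simp)]
  simp [countMatrix, Finset.filter_filter]

theorem sum_countMatrix_col (r : Fin n → Fin p) (s : Fin n → Fin q) (j : Fin q) :
    ∑ i, countMatrix r s i j = (Finset.univ.filter fun t => s t = j).card := by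
  rw [Finset.card_eq_sum_card_fiberwise (f := r) (t := Finset.univ) (by simp)]
  simp [countMatrix, Finset.filter_filter, and_comm]

theorem sum_countMatrix (r : Fin n → Fin p) (s : Fin n → Fin q) :
    ∑ i, ∑ j, countMatrix r s i j = n := by
  simp only [sum_countMatrix_row]
  rw [← Finset.card_eq_sum_card_fiberwise (f := r) (t := Finset.univ) (by simp)]
  simp

theorem isRectComposition_countMatrix_iff {h k : ℕ} (r : Fin n → Fin (h + 2))
    (s : Fin n → Fin (k + 2)) : IsRectComposition n (countMatrix r s) ↔
      (∀ i, i ≠ 0 → i ≠ Fin.last (h + 1) → ∃ t, r t = i) ∧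
      (∀ j, j ≠ 0 → j ≠ Fin.last (k + 1) → ∃ t, s t = j) := by
  constructor
  · intro H
    refine ⟨fun i h0 h1 => ?_, fun i h0 h1 => ?_⟩
    · have := H.row_pos i h0 h1
      rw [sum_countMatrix_row, Finset.card_pos] at this
      obtain ⟨t, ht⟩ := this
      exact ⟨t, (Finset.mem_filter.1 ht).2⟩
    · have := H.col_pos i h0 h1
      rw [sum_countMatrix_col, Finset.card_pos] at this
      obtain ⟨t, ht⟩ := this
      exact ⟨t, (Finset.mem_filter.1 ht).2⟩
  · rintro ⟨h1, h2⟩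
    refine ⟨fun i ha hb => ?_, fun i ha hb => ?_, sum_countMatrix r s⟩
    · rw [sum_countMatrix_row, Finset.card_pos]
      obtain ⟨t, ht⟩ := h1 i ha hb
      exact ⟨t, by simpa using ht⟩
    · rw [sum_countMatrix_col, Finset.card_pos]
      obtain ⟨t, ht⟩ := h2 i ha hb
      exact ⟨t, by simpa using ht⟩

theorem exists_eq_countMatrix (M : Matrix (Fin p) (Fin q) ℕ) (hM : ∑ i, ∑ j, M i j = n) :
    ∃ (r : Fin n → Fin p) (s : Fin n → Fin q), M = countMatrix r s := by
  -- Each entry is split into units; the `n` units are numbered, and each remembers its row and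
  -- column.
  let T := Σ ij : Fin p × Fin q, Fin (M ij.1 ij.2)
  have hT : Fintype.card T = n := by
    simp only [T, Fintype.card_sigma, Fintype.card_fin]
    rw [Fintype.sum_prod_type, hM]
  let e : Fin n ≃ T := (Fintype.equivFinOfCardEq hT).symm
  refine ⟨fun t => (e t).1.1, fun t => (e t).1.2, ?_⟩
  funext i j
  have h1 : countMatrix (fun t => (e t).1.1) (fun t => (e t).1.2) i j =
      (Finset.univ.filter fun x : T => x.1 = (i, j)).card := by
    refine Finset.card_bij (fun t _ => e t) ?_ ?_ ?_
    · intro t ht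
      simpa [Prod.ext_iff] using ht
    · intro t _ t' _ h
      exact e.injective h
    · intro x hx
      exact ⟨e.symm x, by simpa [Prod.ext_iff] using hx, by simp⟩
  rw [h1]
  have h2 : (Finset.univ.filter fun x : T => x.1 = (i, j)) =
      Finset.univ.map (Function.Embedding.sigmaMk (β := fun ij : Fin p × Fin q =>
        Fin (M ij.1 ij.2)) (i, j)) := by
    ext x
    simp only [Finset.mem_filter, Finset.mem_univ, true_and, Finset.mem_map]
    constructor
    · rintro h
      obtain ⟨x1, x2⟩ := x
      subst h
      exact ⟨x2, rfl⟩
    · rintro ⟨y, rfl⟩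
      rfl
  rw [h2, Finset.card_map]
  simp

theorem rowMerge_countMatrix {h k : ℕ} (i : Fin (h + 2)) (r : Fin n → Fin (h + 3))
    (s : Fin n → Fin (k + 2)) :
    rowMerge i (countMatrix r s) = countMatrix (i.predAbove ∘ r) s := by
  funext a b
  simp only [rowMerge, countMatrix]
  rw [Finset.card_eq_sum_card_fiberwise (f := r)
    (t := Finset.univ.filter fun i' => i.predAbove i' = a)]
  · refine Finset.sum_congr rfl fun i' hi' => ?_
    congr 1
    ext t
    have := (Finset.mem_filter.1 hi').2
    simp only [Finset.mem_filter, Finset.mem_univ, true_and, Function.comp]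
    constructor
    · rintro ⟨rfl, h⟩
      exact ⟨⟨this, h⟩, rfl⟩
    · rintro ⟨⟨_, h⟩, h'⟩
      exact ⟨h', h⟩
  · intro t ht
    simp only [Finset.coe_filter, Finset.mem_univ, true_and, Set.mem_ofPred_eq] at ht ⊢
    exact ht.1

theorem colMerge_countMatrix {h k : ℕ} (i : Fin (k + 2)) (r : Fin n → Fin (h + 2))
    (s : Fin n → Fin (k + 3)) :
    colMerge i (countMatrix r s) = countMatrix r (i.predAbove ∘ s) := by
  funext a b
  simp only [colMerge, countMatrix]
  rw [Finset.card_eq_sum_card_fiberwise (f := s)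
    (t := Finset.univ.filter fun i' => i.predAbove i' = b)]
  · refine Finset.sum_congr rfl fun i' hi' => ?_
    congr 1
    ext t
    have := (Finset.mem_filter.1 hi').2
    simp only [Finset.mem_filter, Finset.mem_univ, true_and, Function.comp]
    constructor
    · rintro ⟨h, rfl⟩
      exact ⟨⟨h, this⟩, rfl⟩
    · rintro ⟨⟨h, _⟩, h'⟩
      exact ⟨h, h'⟩
  · intro t ht
    simp only [Finset.coe_filter, Finset.mem_univ, true_and, Set.mem_ofPred_eq] at ht ⊢
    exact ht.2

theorem exists_comp_eq_of_monotone_surjective {h h' : ℕ} {r : Fin n → Fin (h + 2)}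
    {ρ : Fin (h + 2) → Fin (h' + 2)} (hm : Monotone ρ) (hs : Function.Surjective ρ)
    (H : ∀ i, i ≠ 0 → i ≠ Fin.last (h + 1) → ∃ t, r t = i) (i : Fin (h' + 2)) (h0 : i ≠ 0)
    (h1 : i ≠ Fin.last (h' + 1)) : ∃ t, (ρ ∘ r) t = i := by
  obtain ⟨j, rfl⟩ := hs i
  obtain ⟨t, ht⟩ := H j (fun hj => h0 (by rw [hj, Fin.map_zero_of_monotone_surjective hm hs]))
    (fun hj => h1 (by rw [hj, Fin.map_last_of_monotone_surjective hm hs]))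
  exact ⟨t, by simp [ht]⟩

/-- The order on rectangular compositions, in terms of monotone surjections. -/
theorem RectComp.le_iff {a b : RectComp n} {r : Fin n → Fin (b.h + 2)} {s : Fin n → Fin (b.k + 2)}
    (hb : b.mat = countMatrix r s) :
    a ≤ b ↔ ∃ (ρ : Fin (b.h + 2) → Fin (a.h + 2)) (γ : Fin (b.k + 2) → Fin (a.k + 2)),
      Monotone ρ ∧ Function.Surjective ρ ∧ Monotone γ ∧ Function.Surjective γ ∧
      a.mat = countMatrix (ρ ∘ r) (γ ∘ s) := by
  constructor
  · intro hab
    change Relation.ReflTransGen Merge b a at hab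
    induction hab with
    | refl => exact ⟨id, id, monotone_id, Function.surjective_id, monotone_id,
        Function.surjective_id, hb⟩
    | tail _ hm ih =>
      obtain ⟨ρ, γ, h1, h2, h3, h4, h5⟩ := ih
      cases hm with
      | row i M hM hN =>
        simp only at h5 ρ γ
        refine ⟨i.predAbove ∘ ρ, γ, (Fin.predAbove_right_monotone i).comp h1,
          i.predAbove_surjective.comp h2, h3, h4, ?_⟩
        simp only [h5]
        exact rowMerge_countMatrix i _ _
      | col i M hM hN =>
        simp only at h5 ρ γ
        refine ⟨ρ, i.predAbove ∘ γ, h1, h2, (Fin.predAbove_right_monotone i).comp h3,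
          i.predAbove_surjective.comp h4, ?_⟩
        simp only [h5]
        exact colMerge_countMatrix i _ _
  · rintro ⟨ρ, γ, h1, h2, h3, h4, h5⟩
    obtain ⟨N, hN⟩ : ∃ N, b.h + b.k = N := ⟨_, rfl⟩
    -- As long as `ρ` or `γ` shortens its chain, it factors through the merging of two neighbours,
    -- which is one row-merge or column-merge. When neither does, both are identities.
    induction N using Nat.strong_induction_on generalizing b with
    | _ N ih =>
    have hc : IsRectComposition n (countMatrix r s) := hb ▸ b.isComp
    have hc' := (isRectComposition_countMatrix_iff r s).1 hc
    have hle := Fin.le_of_surjective _ h2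
    have hle' := Fin.le_of_surjective _ h4
    obtain ⟨ah, ak, aM, aC⟩ := a
    obtain ⟨bh, bk, bM, bC⟩ := b
    simp only at hb ρ γ h1 h2 h3 h4 h5 hle hle' hN r s hc hc'
    subst hb h5
    rcases Nat.lt_or_ge ah bh with hlt | hge
    · obtain ⟨m, rfl⟩ : ∃ m, bh = m + 1 := ⟨bh - 1, by omega⟩
      obtain ⟨i, ρ', hm', hs', hρ⟩ := Fin.exists_eq_comp_predAbove h1 h2 (by omega)
      have hcomp : IsRectComposition n (rowMerge i (countMatrix r s)) := by
        rw [rowMerge_countMatrix, isRectComposition_countMatrix_iff]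
        exact ⟨exists_comp_eq_of_monotone_surjective (Fin.predAbove_right_monotone i)
          i.predAbove_surjective hc'.1, hc'.2⟩
      refine Relation.ReflTransGen.head (Merge.row i _ bC hcomp) ?_
      refine ih (m + bk) (by omega) (b := ⟨m, bk, _, hcomp⟩) (rowMerge_countMatrix i r s) ρ' γ
        hm' hs' h3 h4 ?_ rfl
      simp only [hρ]
      rfl
    · obtain rfl : ah = bh := by omega
      obtain rfl := Fin.eq_id_of_monotone_surjective h1 h2
      rcases Nat.lt_or_ge ak bk with hlt | hge
      · obtain ⟨m, rfl⟩ : ∃ m, bk = m + 1 := ⟨bk - 1, by omega⟩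
        obtain ⟨i, ρ', hm', hs', hρ⟩ := Fin.exists_eq_comp_predAbove h3 h4 (by omega)
        have hcomp : IsRectComposition n (colMerge i (countMatrix r s)) := by
          rw [colMerge_countMatrix, isRectComposition_countMatrix_iff]
          exact ⟨hc'.1, exists_comp_eq_of_monotone_surjective (Fin.predAbove_right_monotone i)
            i.predAbove_surjective hc'.2⟩
        refine Relation.ReflTransGen.head (Merge.col i _ bC hcomp) ?_
        refine ih (ah + m) (by omega) (b := ⟨ah, m, _, hcomp⟩) (colMerge_countMatrix i r s) id ρ'
          h1 h2 hm' hs' ?_ rfl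
        simp only [hρ]
        rfl
      · obtain rfl : ak = bk := by omega
        obtain rfl := Fin.eq_id_of_monotone_surjective h3 h4
        exact Relation.ReflTransGen.refl

/-- The fibres of the two index maps over each position have the same size; bijections between them
assemble to a permutation. -/
theorem exists_perm_of_countMatrix_eq {r r' : Fin n → Fin p} {s s' : Fin n → Fin q}
    (h : countMatrix r s = countMatrix r' s') :
    ∃ σ : Equiv.Perm (Fin n), r = r' ∘ σ ∧ s = s' ∘ σ := by
  have hcard : ∀ c : Fin p × Fin q,
      Nonempty ({t // (r t, s t) = c} ≃ {t // (r' t, s' t) = c}) := by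
    intro c
    refine ⟨Fintype.equivOfCardEq ?_⟩
    have := congrFun (congrFun h c.1) c.2
    simpa [countMatrix, Fintype.card_subtype, Prod.ext_iff] using this
  let σ := Equiv.ofFiberEquiv (fun c => (hcard c).some)
  have hσ : ∀ t, (r' (σ t), s' (σ t)) = (r t, s t) := fun t =>
    Equiv.ofFiberEquiv_map (fun c => (hcard c).some) t
  exact ⟨σ, funext fun t => (Prod.ext_iff.1 (hσ t)).1.symm,
    funext fun t => (Prod.ext_iff.1 (hσ t)).2.symm⟩

end CountMatrix

/-! ### Multisets in the rectangle as matched coordinate tuples. -/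

section Coordinates

variable {n : ℕ} {xl xr yb yt : ℝ}

/-- The coordinate rectangle `[xl, xr] + i [yb, yt]`. -/
abbrev coordRect (xl xr yb yt : ℝ) : Set ℂ := Set.Icc xl xr ×ℂ Set.Icc yb yt

/-- The multiset of the points `x t + i y t`. -/
def multOfCoords (x y : Fin n → ℝ) (hx : ∀ t, x t ∈ Set.Icc xl xr) (hy : ∀ t, y t ∈ Set.Icc yb yt) :
    Mult n (coordRect xl xr yb yt) :=
  Mult.mk fun t => ⟨⟨x t, y t⟩, hx t, hy t⟩

theorem multOfCoords_eq_iff {x y x' y' : Fin n → ℝ} {hx : ∀ t, x t ∈ Set.Icc xl xr}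
    {hy : ∀ t, y t ∈ Set.Icc yb yt} {hx' : ∀ t, x' t ∈ Set.Icc xl xr}
    {hy' : ∀ t, y' t ∈ Set.Icc yb yt} :
    multOfCoords x y hx hy = multOfCoords x' y' hx' hy' ↔
      ∃ σ : Equiv.Perm (Fin n), x = x' ∘ σ ∧ y = y' ∘ σ := by
  constructor
  · intro h
    obtain ⟨σ, hσ⟩ := Quotient.exact (s := permSetoid n _) h
    refine ⟨σ, funext fun t => ?_, funext fun t => ?_⟩
    · exact congrArg (fun z : coordRect xl xr yb yt => (z : ℂ).re) (congrFun hσ t)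
    · exact congrArg (fun z : coordRect xl xr yb yt => (z : ℂ).im) (congrFun hσ t)
  · rintro ⟨σ, rfl, rfl⟩
    exact Quotient.sound (s := permSetoid n _) ⟨σ, rfl⟩

/-- Every multiset in the rectangle is given by a sorted tuple of real parts and a sorted tuple of
imaginary parts, matched by a permutation. -/
theorem mk_eq_multOfCoords_sorted (z : Fin n → coordRect xl xr yb yt) (π ρ : Equiv.Perm (Fin n)) :
    Mult.mk z = multOfCoords (fun t => (z (π t) : ℂ).re)
      ((fun t => (z (ρ t) : ℂ).im) ∘ ⇑(ρ⁻¹ * π)) (fun t => (z (π t)).2.1) (fun t => by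
        simpa using (z (π t)).2.2) := by
  refine Quotient.sound (s := permSetoid n _) ⟨π⁻¹, ?_⟩
  funext t
  ext
  apply Complex.ext <;> simp

theorem exists_eq_multOfCoords_sorted (hx : xl < xr) (hy : yb < yt)
    (z : Mult n (coordRect xl xr yb yt)) :
    ∃ (x y : Fin n → ℝ) (σ : Equiv.Perm (Fin n)) (h : Monotone (padEnds xl xr x))
      (h' : Monotone (padEnds yb yt y)),
      z = multOfCoords x (y ∘ σ) (monotone_padEnds_mem h)
        (fun t => monotone_padEnds_mem h' (σ t)) := by
  obtain ⟨w, rfl⟩ := Quotient.exists_rep z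
  refine ⟨_, _, _, ?_, ?_, mk_eq_multOfCoords_sorted w
    (Tuple.sort fun t => (w t : ℂ).re) (Tuple.sort fun t => (w t : ℂ).im)⟩
  · exact monotone_padEnds hx.le (Tuple.monotone_sort fun t => (w t : ℂ).re) fun t => (w _).2.1
  · exact monotone_padEnds hy.le (Tuple.monotone_sort fun t => (w t : ℂ).im) fun t => (w _).2.2

end Coordinates

/-! ### Grids of coordinates, and existence, uniqueness and order of multiplicity matrices. -/

section Grid

/-- The entries of the tuple `x` are the values of a strictly monotone tuple `g` with first entry
`a` and last entry `b`, at the indices `r`. -/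
structure IsGrid (a b : ℝ) {n h : ℕ} (x : Fin n → ℝ) (g : Fin (h + 2) → ℝ)
    (r : Fin n → Fin (h + 2)) : Prop where
  strictMono : StrictMono g
  zero : g 0 = a
  last : g (Fin.last (h + 1)) = b
  eq : x = g ∘ r

/-- By `H`, every internal value of `g` is an entry of `x`, hence a value of any other grid for `x`.
Applied both ways, this shows that such a grid is determined by `x`. -/
theorem IsGrid.range_subset {a b : ℝ} {n h h' : ℕ} {x : Fin n → ℝ} {g : Fin (h + 2) → ℝ}
    {r : Fin n → Fin (h + 2)} {g' : Fin (h' + 2) → ℝ} {r' : Fin n → Fin (h' + 2)}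
    (hg : IsGrid a b x g r) (hg' : IsGrid a b x g' r')
    (H : ∀ i, i ≠ 0 → i ≠ Fin.last (h + 1) → ∃ t, r t = i) : Set.range g ⊆ Set.range g' := by
  rintro _ ⟨i, rfl⟩
  by_cases h0 : i = 0
  · exact ⟨0, by rw [h0, hg.zero, hg'.zero]⟩
  by_cases h1 : i = Fin.last (h + 1)
  · exact ⟨Fin.last _, by rw [h1, hg.last, hg'.last]⟩
  obtain ⟨t, rfl⟩ := H i h0 h1
  exact ⟨r' t, by rw [← Function.comp_apply (f := g'), ← hg'.eq, hg.eq, Function.comp_apply]⟩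

theorem eq_of_range_eq {p q : ℕ} {g : Fin p → ℝ} {g' : Fin q → ℝ} (hg : StrictMono g)
    (hg' : StrictMono g') (h : Set.range g = Set.range g') : p = q := by
  have h1 := Nat.card_congr (Equiv.ofInjective g hg.injective)
  have h2 := Nat.card_congr (Equiv.ofInjective g' hg'.injective)
  rw [h, ← h2] at h1
  simpa using h1

variable {n : ℕ} {xl xr yb yt : ℝ}

theorem count_multOfCoords (x y : Fin n → ℝ) (hx : ∀ t, x t ∈ Set.Icc xl xr)
    (hy : ∀ t, y t ∈ Set.Icc yb yt) (p q : ℝ) :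
    ((multOfCoords x y hx hy).map Subtype.val).count (⟨p, q⟩ : ℂ) =
      (Finset.univ.filter fun t => x t = p ∧ y t = q).card := by
  classical
  change Nat.card {t : Fin n // (⟨x t, y t⟩ : ℂ) = ⟨p, q⟩} = _
  rw [Nat.card_eq_fintype_card, Fintype.card_subtype]
  simp [Complex.ext_iff]

theorem isMultiplicityMatrix_multOfCoords_iff (x y : Fin n → ℝ) (hx : ∀ t, x t ∈ Set.Icc xl xr)
    (hy : ∀ t, y t ∈ Set.Icc yb yt) (a : RectComp n) :
    IsMultiplicityMatrix xl xr yb yt (multOfCoords x y hx hy) a ↔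
      ∃ (g : Fin (a.h + 2) → ℝ) (g' : Fin (a.k + 2) → ℝ) (r : Fin n → Fin (a.h + 2))
        (s : Fin n → Fin (a.k + 2)), IsGrid xl xr x g r ∧ IsGrid yb yt y g' s ∧
        a.mat = countMatrix r s := by
  classical
  have hcount : ∀ (g : Fin (a.h + 2) → ℝ) (g' : Fin (a.k + 2) → ℝ) (r : Fin n → Fin (a.h + 2))
      (s : Fin n → Fin (a.k + 2)), IsGrid xl xr x g r → IsGrid yb yt y g' s → ∀ i j,
      (Finset.univ.filter fun t => x t = g i ∧ y t = g' j).card = countMatrix r s i j := by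
    intro g g' r s hg hg' i j
    simp only [countMatrix, hg.eq, hg'.eq, Function.comp, hg.strictMono.injective.eq_iff,
      hg'.strictMono.injective.eq_iff]
  constructor
  · rintro ⟨g, g', h1, h2, h3, h4, h5, h6, h7⟩
    simp only [count_multOfCoords] at h7
    have hall : ∀ t, ∃ i j, x t = g i ∧ y t = g' j := by
      let B : Fin (a.h + 2) × Fin (a.k + 2) → Finset (Fin n) := fun ij =>
        Finset.univ.filter fun t => x t = g ij.1 ∧ y t = g' ij.2
      have hdisj : ((Finset.univ : Finset (Fin (a.h + 2) × Fin (a.k + 2))) :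
          Set (Fin (a.h + 2) × Fin (a.k + 2))).PairwiseDisjoint B := by
        intro ij _ ij' _ hne
        refine Finset.disjoint_left.2 fun t ht ht' => hne ?_
        have h1' := (Finset.mem_filter.1 ht).2
        have h2' := (Finset.mem_filter.1 ht').2
        exact Prod.ext (h1.injective (h1'.1.symm.trans h2'.1))
          (h4.injective (h1'.2.symm.trans h2'.2))
      -- The index sets over different grid points are disjoint, and their sizes add up to the entry
      -- sum `n`, so every index lies over some grid point.
      have hcard : (Finset.univ.biUnion B).card = Fintype.card (Fin n) := by
        rw [Finset.card_biUnion hdisj, Fintype.sum_prod_type, Fintype.card_fin]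
        simp only [B, h7]
        exact a.isComp.sum_eq
      intro t
      have ht : t ∈ Finset.univ.biUnion B := by
        rw [Finset.eq_univ_of_card _ hcard]
        exact Finset.mem_univ t
      obtain ⟨ij, -, hij⟩ := Finset.mem_biUnion.1 ht
      exact ⟨ij.1, ij.2, (Finset.mem_filter.1 hij).2⟩
    choose r s hr hs using hall
    have hg : IsGrid xl xr x g r := ⟨h1, h2, h3, funext hr⟩
    have hg' : IsGrid yb yt y g' s := ⟨h4, h5, h6, funext hs⟩
    refine ⟨g, g', r, s, hg, hg', ?_⟩
    funext i j
    rw [← h7, hcount g g' r s hg hg']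
  · rintro ⟨g, g', r, s, hg, hg', h⟩
    refine ⟨g, g', hg.strictMono, hg.zero, hg.last, hg'.strictMono, hg'.zero, hg'.last, ?_⟩
    intro i j
    rw [count_multOfCoords, h, hcount g g' r s hg hg']

theorem IsMultiplicityMatrix.unique (hx : xl < xr) (hy : yb < yt)
    {z : Mult n (coordRect xl xr yb yt)} {a b : RectComp n}
    (ha : IsMultiplicityMatrix xl xr yb yt z a) (hb : IsMultiplicityMatrix xl xr yb yt z b) :
    a = b := by
  obtain ⟨x, y, σ, h, h', rfl⟩ := exists_eq_multOfCoords_sorted hx hy z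
  rw [isMultiplicityMatrix_multOfCoords_iff] at ha hb
  obtain ⟨g₁, g₁', r₁, s₁, hg₁, hg₁', h₁⟩ := ha
  obtain ⟨g₂, g₂', r₂, s₂, hg₂, hg₂', h₂⟩ := hb
  obtain ⟨ah, ak, aM, aC⟩ := a
  obtain ⟨bh, bk, bM, bC⟩ := b
  simp only at h₁ h₂ g₁ g₁' g₂ g₂' r₁ r₂ s₁ s₂ hg₁ hg₂ hg₁' hg₂'
  subst h₁ h₂
  have c₁ := (isRectComposition_countMatrix_iff _ _).1 aC
  have c₂ := (isRectComposition_countMatrix_iff _ _).1 bC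
  have e₁ := (hg₁.range_subset hg₂ c₁.1).antisymm (hg₂.range_subset hg₁ c₂.1)
  have e₂ := (hg₁'.range_subset hg₂' c₁.2).antisymm (hg₂'.range_subset hg₁' c₂.2)
  obtain rfl : ah = bh := by simpa using eq_of_range_eq hg₁.strictMono hg₂.strictMono e₁
  obtain rfl : ak = bk := by simpa using eq_of_range_eq hg₁'.strictMono hg₂'.strictMono e₂
  obtain rfl := (hg₁.strictMono.range_inj hg₂.strictMono).1 e₁
  obtain rfl := (hg₁'.strictMono.range_inj hg₂'.strictMono).1 e₂
  obtain rfl : r₁ = r₂ := hg₁.strictMono.injective.comp_left (hg₁.eq.symm.trans hg₂.eq)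
  obtain rfl : s₁ = s₂ := hg₁'.strictMono.injective.comp_left (hg₁'.eq.symm.trans hg₂'.eq)
  rfl

theorem exists_inner_eq {h : ℕ} {r : Fin (n + 2) → Fin (h + 2)} (hm : Monotone r)
    (hs : Function.Surjective r) (i : Fin (h + 2)) (h0 : i ≠ 0) (h1 : i ≠ Fin.last (h + 1)) :
    ∃ t : Fin n, r t.castSucc.succ = i := by
  obtain ⟨j, rfl⟩ := hs i
  refine forall_fin_padEnds (p := fun j => r j ≠ 0 → r j ≠ Fin.last (h + 1) →
    ∃ t : Fin n, r t.castSucc.succ = r j) ?_ ?_ ?_ j h0 h1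
  · exact fun h _ => absurd (Fin.map_zero_of_monotone_surjective hm hs) h
  · exact fun _ h => absurd (Fin.map_last_of_monotone_surjective hm hs) h
  · exact fun t _ _ => ⟨t, rfl⟩

/-- The indices of the entries of a sorted tuple in its grid. -/
structure IsSortedGrid (a b : ℝ) {n h : ℕ} (x : Fin n → ℝ) (g : Fin (h + 2) → ℝ)
    (r : Fin (n + 2) → Fin (h + 2)) : Prop where
  strictMono : StrictMono g
  monotone : Monotone r
  surjective : Function.Surjective r
  eq : padEnds a b x = g ∘ r

theorem exists_isSortedGrid {a b : ℝ} (hab : a < b) {x : Fin n → ℝ}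
    (hx : Monotone (padEnds a b x)) :
    ∃ (h : ℕ) (g : Fin (h + 2) → ℝ) (r : Fin (n + 2) → Fin (h + 2)), IsSortedGrid a b x g r := by
  obtain ⟨h, g, r, h1, h2, h3, h4⟩ := exists_strictMono_comp hx (by simpa using hab)
  exact ⟨h, g, r, h1, h2, h3, h4⟩

theorem IsSortedGrid.zero {a b : ℝ} {h : ℕ} {x : Fin n → ℝ} {g : Fin (h + 2) → ℝ}
    {r : Fin (n + 2) → Fin (h + 2)} (H : IsSortedGrid a b x g r) : g 0 = a := by
  have := congrFun H.eq 0
  rw [Function.comp_apply, Fin.map_zero_of_monotone_surjective H.monotone H.surjective] at this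
  rw [← this, padEnds_zero]

theorem IsSortedGrid.last {a b : ℝ} {h : ℕ} {x : Fin n → ℝ} {g : Fin (h + 2) → ℝ}
    {r : Fin (n + 2) → Fin (h + 2)} (H : IsSortedGrid a b x g r) :
    g (Fin.last (h + 1)) = b := by
  have := congrFun H.eq (Fin.last _)
  rw [Function.comp_apply, Fin.map_last_of_monotone_surjective H.monotone H.surjective] at this
  rw [← this, padEnds_last]

theorem IsSortedGrid.isGrid {a b : ℝ} {h : ℕ} {x : Fin n → ℝ} {g : Fin (h + 2) → ℝ}
    {r : Fin (n + 2) → Fin (h + 2)} (H : IsSortedGrid a b x g r) (σ : Equiv.Perm (Fin n)) :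
    IsGrid a b (x ∘ σ) g (fun t => r (σ t).castSucc.succ) :=
  ⟨H.strictMono, H.zero, H.last, funext fun t => by
    have := congrFun H.eq (σ t).castSucc.succ
    rwa [padEnds_inner] at this⟩

theorem IsSortedGrid.exists_perm_eq {a b : ℝ} {h : ℕ} {x : Fin n → ℝ} {g : Fin (h + 2) → ℝ}
    {r : Fin (n + 2) → Fin (h + 2)} (H : IsSortedGrid a b x g r) (σ : Equiv.Perm (Fin n))
    (i : Fin (h + 2)) (h0 : i ≠ 0) (h1 : i ≠ Fin.last (h + 1)) :
    ∃ t : Fin n, r (σ t).castSucc.succ = i := by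
  obtain ⟨t, ht⟩ := exists_inner_eq H.monotone H.surjective i h0 h1
  exact ⟨σ.symm t, by simpa using ht⟩

/-- The composition of a pair of grids matched by a permutation. -/
def gridComp {h k : ℕ} {x y : Fin n → ℝ} {g : Fin (h + 2) → ℝ} {g' : Fin (k + 2) → ℝ}
    {r : Fin (n + 2) → Fin (h + 2)} {s : Fin (n + 2) → Fin (k + 2)}
    (hr : IsSortedGrid xl xr x g r) (hs : IsSortedGrid yb yt y g' s) (σ : Equiv.Perm (Fin n)) :
    RectComp n where
  h := h
  k := k
  mat := countMatrix (fun t => r t.castSucc.succ) (fun t => s (σ t).castSucc.succ)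
  isComp := (isRectComposition_countMatrix_iff _ _).2
    ⟨hr.exists_perm_eq 1, hs.exists_perm_eq σ⟩

theorem isMultiplicityMatrix_gridComp {h k : ℕ} {x y : Fin n → ℝ} {g : Fin (h + 2) → ℝ}
    {g' : Fin (k + 2) → ℝ} {r : Fin (n + 2) → Fin (h + 2)} {s : Fin (n + 2) → Fin (k + 2)}
    (hr : IsSortedGrid xl xr x g r) (hs : IsSortedGrid yb yt y g' s) (σ : Equiv.Perm (Fin n))
    (hx : ∀ t, x t ∈ Set.Icc xl xr) (hy : ∀ t, (y ∘ σ) t ∈ Set.Icc yb yt) :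
    IsMultiplicityMatrix xl xr yb yt (multOfCoords x (y ∘ σ) hx hy) (gridComp hr hs σ) := by
  rw [isMultiplicityMatrix_multOfCoords_iff]
  exact ⟨g, g', _, _, hr.isGrid 1, hs.isGrid σ, rfl⟩

theorem exists_isMultiplicityMatrix (hx : xl < xr) (hy : yb < yt)
    (z : Mult n (coordRect xl xr yb yt)) : ∃ a, IsMultiplicityMatrix xl xr yb yt z a := by
  obtain ⟨x, y, σ, h, h', rfl⟩ := exists_eq_multOfCoords_sorted hx hy z
  obtain ⟨_, _, _, hr⟩ := exists_isSortedGrid hx h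
  obtain ⟨_, _, _, hs⟩ := exists_isSortedGrid hy h'
  exact ⟨_, isMultiplicityMatrix_gridComp hr hs σ _ _⟩

theorem exists_strictMono_ends {a b : ℝ} (hab : a < b) (h : ℕ) :
    ∃ g : Fin (h + 2) → ℝ, StrictMono g ∧ g 0 = a ∧ g (Fin.last (h + 1)) = b := by
  refine ⟨fun i => a + (b - a) * (i / (h + 1)), ?_, by simp, ?_⟩
  · intro i j hij
    have h1 : ((i : ℕ) : ℝ) < ((j : ℕ) : ℝ) := by exact_mod_cast hij
    have h2 : 0 < b - a := sub_pos.2 hab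
    have h3 : (0 : ℝ) < h + 1 := by positivity
    simp only
    gcongr
  · have h3 : (h + 1 : ℝ) ≠ 0 := by positivity
    simp [div_self h3]

theorem exists_isMultiplicityMatrix_of_rectComp (hx : xl < xr) (hy : yb < yt) (a : RectComp n) :
    ∃ z : Mult n (coordRect xl xr yb yt), IsMultiplicityMatrix xl xr yb yt z a := by
  obtain ⟨r, s, hrs⟩ := exists_eq_countMatrix a.mat a.isComp.sum_eq
  obtain ⟨g, h1, h2, h3⟩ := exists_strictMono_ends hx a.h
  obtain ⟨g', h4, h5, h6⟩ := exists_strictMono_ends hy a.k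
  have hg : ∀ t, (g ∘ r) t ∈ Set.Icc xl xr := fun t =>
    ⟨h2.symm.le.trans (h1.monotone (Fin.zero_le _)), (h1.monotone (Fin.le_last _)).trans h3.le⟩
  have hg' : ∀ t, (g' ∘ s) t ∈ Set.Icc yb yt := fun t =>
    ⟨h5.symm.le.trans (h4.monotone (Fin.zero_le _)), (h4.monotone (Fin.le_last _)).trans h6.le⟩
  exact ⟨multOfCoords (g ∘ r) (g' ∘ s) hg hg', (isMultiplicityMatrix_multOfCoords_iff _ _ _ _ _).2
    ⟨g, g', r, s, ⟨h1, h2, h3, rfl⟩, ⟨h4, h5, h6, rfl⟩, hrs⟩⟩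

/-- The hypothesis `hf` says that padded coordinates equal in `x` stay equal in `x'`, so the
position in the grid of `x` determines that in the grid of `x'`. -/
theorem IsSortedGrid.exists_collapse {a b : ℝ} {h h' : ℕ} {x x' : Fin n → ℝ}
    {g : Fin (h + 2) → ℝ} {r : Fin (n + 2) → Fin (h + 2)} (H : IsSortedGrid a b x g r)
    {g' : Fin (h' + 2) → ℝ} {r' : Fin (n + 2) → Fin (h' + 2)} (H' : IsSortedGrid a b x' g' r')
    (hf : Function.FactorsThrough (padEnds a b x') (padEnds a b x)) :
    ∃ ρ : Fin (h + 2) → Fin (h' + 2), Monotone ρ ∧ Function.Surjective ρ ∧ r' = ρ ∘ r := by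
  refine exists_monotone_surjective_comp H.monotone H.surjective H'.monotone H'.surjective ?_
  intro i j hij
  apply H'.strictMono.injective
  have := hf (show padEnds a b x i = padEnds a b x j by rw [H.eq]; simp [hij])
  rwa [H'.eq] at this

theorem IsSortedGrid.collapse {a b : ℝ} {h h' : ℕ} {x : Fin n → ℝ}
    {g : Fin (h + 2) → ℝ} {r : Fin (n + 2) → Fin (h + 2)} (H : IsSortedGrid a b x g r)
    {ρ : Fin (h + 2) → Fin (h' + 2)} (hρ : Monotone ρ) (hρs : Function.Surjective ρ)
    {g' : Fin (h' + 2) → ℝ} (hg : StrictMono g') (h0 : g' 0 = a)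
    (h1 : g' (Fin.last (h' + 1)) = b) :
    IsSortedGrid a b (fun t : Fin n => g' (ρ (r t.castSucc.succ))) g' (ρ ∘ r) ∧
    Function.FactorsThrough (padEnds a b fun t : Fin n => g' (ρ (r t.castSucc.succ)))
      (padEnds a b x) := by
  have hm := hρ.comp H.monotone
  have hs := hρs.comp H.surjective
  have heq : padEnds a b (fun t : Fin n => g' (ρ (r t.castSucc.succ))) = g' ∘ (ρ ∘ r) := by
    refine eq_padEnds (X := g' ∘ (ρ ∘ r)) ?_ ?_
    · rw [Function.comp_apply, Fin.map_zero_of_monotone_surjective hm hs, h0]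
    · rw [Function.comp_apply, Fin.map_last_of_monotone_surjective hm hs, h1]
  refine ⟨⟨hg, hm, hs, heq⟩, ?_⟩
  rw [heq]
  intro i j hij
  rw [H.eq] at hij
  simp [H.strictMono.injective hij]

theorem IsSortedGrid.monotone_padEnds {a b : ℝ} {h : ℕ} {x : Fin n → ℝ} {g : Fin (h + 2) → ℝ}
    {r : Fin (n + 2) → Fin (h + 2)} (H : IsSortedGrid a b x g r) : Monotone (padEnds a b x) := by
  rw [H.eq]
  exact H.strictMono.monotone.comp H.monotone

/-- The multisets whose composition is at most that of a given multiset are those obtained by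
collapsing its sorted coordinates. -/
theorem exists_collapse_iff (hx : xl < xr) (hy : yb < yt) {x y : Fin n → ℝ}
    (σ : Equiv.Perm (Fin n)) (h : Monotone (padEnds xl xr x)) (h' : Monotone (padEnds yb yt y))
    {w : Mult n (coordRect xl xr yb yt)} {a b : RectComp n}
    (ha : IsMultiplicityMatrix xl xr yb yt w a)
    (hb : IsMultiplicityMatrix xl xr yb yt (multOfCoords x (y ∘ σ) (monotone_padEnds_mem h)
      (fun t => monotone_padEnds_mem h' (σ t))) b) :
    (∃ (x' y' : Fin n → ℝ) (k : Monotone (padEnds xl xr x')) (k' : Monotone (padEnds yb yt y')),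
      Function.FactorsThrough (padEnds xl xr x') (padEnds xl xr x) ∧
      Function.FactorsThrough (padEnds yb yt y') (padEnds yb yt y) ∧
      w = multOfCoords x' (y' ∘ σ) (monotone_padEnds_mem k)
        (fun t => monotone_padEnds_mem k' (σ t))) ↔ a ≤ b := by
  obtain ⟨_, _, _, hr⟩ := exists_isSortedGrid hx h
  obtain ⟨_, _, _, hs⟩ := exists_isSortedGrid hy h'
  obtain rfl := hb.unique hx hy (isMultiplicityMatrix_gridComp hr hs σ _ _)
  rw [RectComp.le_iff (b := gridComp hr hs σ) rfl]
  constructor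
  · rintro ⟨x', y', k, k', f, f', rfl⟩
    obtain ⟨_, _, _, hr'⟩ := exists_isSortedGrid hx k
    obtain ⟨_, _, _, hs'⟩ := exists_isSortedGrid hy k'
    obtain rfl := ha.unique hx hy (isMultiplicityMatrix_gridComp hr' hs' σ _ _)
    obtain ⟨ρ, h1, h2, rfl⟩ := hr.exists_collapse hr' f
    obtain ⟨γ, h3, h4, rfl⟩ := hs.exists_collapse hs' f'
    exact ⟨ρ, γ, h1, h2, h3, h4, rfl⟩
  · rintro ⟨ρ, γ, h1, h2, h3, h4, h5⟩
    obtain ⟨u, v, τ, k, k', rfl⟩ := exists_eq_multOfCoords_sorted hx hy w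
    rw [isMultiplicityMatrix_multOfCoords_iff] at ha
    obtain ⟨g, g', r', s', hg, hg', h6⟩ := ha
    -- The collapsed index maps are given the values of the grid of `w`. The resulting tuples have
    -- the same count matrix as `w`, so they agree with it up to a permutation.
    obtain ⟨e1, e2⟩ := hr.collapse h1 h2 hg.strictMono hg.zero hg.last
    obtain ⟨e3, e4⟩ := hs.collapse h3 h4 hg'.strictMono hg'.zero hg'.last
    refine ⟨_, _, e1.monotone_padEnds, e3.monotone_padEnds, e2, e4, ?_⟩
    rw [multOfCoords_eq_iff]
    obtain ⟨π, hπ1, hπ2⟩ := exists_perm_of_countMatrix_eq (h6.symm.trans h5)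
    refine ⟨π, ?_, ?_⟩
    · rw [hg.eq, hπ1]
      rfl
    · rw [hg'.eq, hπ2]
      rfl

end Grid

/-! ### Splitting the coordinates into real and imaginary halves. -/

section Halves

variable {n : ℕ}

/-- The first `n` of `n + n` coordinates. -/
def firstHalf (u : EuclideanSpace ℝ (Fin (n + n))) : Fin n → ℝ := fun i => u (Fin.castAdd n i)

/-- The last `n` of `n + n` coordinates. -/
def secondHalf (u : EuclideanSpace ℝ (Fin (n + n))) : Fin n → ℝ := fun i => u (Fin.natAdd n i)

/-- The vector with given first and last `n` coordinates. -/
def joinHalves : ((Fin n → ℝ) × (Fin n → ℝ)) →ₗ[ℝ] EuclideanSpace ℝ (Fin (n + n)) where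
  toFun p := WithLp.toLp 2 (Fin.append p.1 p.2)
  map_add' p q := by
    ext i
    refine Fin.addCases (fun i => ?_) (fun i => ?_) i <;> simp [-Fin.natAdd_eq_addNat]
  map_smul' t p := by
    ext i
    refine Fin.addCases (fun i => ?_) (fun i => ?_) i <;> simp [-Fin.natAdd_eq_addNat]

@[simp] theorem firstHalf_joinHalves (p : (Fin n → ℝ) × (Fin n → ℝ)) :
    firstHalf (joinHalves p) = p.1 := by
  funext i
  exact Fin.append_left p.1 p.2 i

@[simp] theorem secondHalf_joinHalves (p : (Fin n → ℝ) × (Fin n → ℝ)) :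
    secondHalf (joinHalves p) = p.2 := by
  funext i
  exact Fin.append_right p.1 p.2 i

theorem ext_halves {u v : EuclideanSpace ℝ (Fin (n + n))} (h1 : firstHalf u = firstHalf v)
    (h2 : secondHalf u = secondHalf v) : u = v := by
  ext i
  refine Fin.addCases (fun i => ?_) (fun i => ?_) i
  · exact congrFun h1 i
  · exact congrFun h2 i

theorem dist_eq_sqrt_halves (u v : EuclideanSpace ℝ (Fin (n + n))) :
    dist u v = √(∑ i, (firstHalf u i - firstHalf v i) ^ 2 +
      ∑ i, (secondHalf u i - secondHalf v i) ^ 2) := by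
  rw [EuclideanSpace.dist_eq, Fin.sum_univ_add]
  simp only [Real.dist_eq, sq_abs]
  rfl

end Halves

/-! ### The polytope of sorted pairs and its faces. -/

section SortedCell

variable {n : ℕ} {xl xr yb yt : ℝ}

/-- The polytope of all pairs of sorted `n`-tuples in `[xl, xr]` and in `[yb, yt]`. -/
def sortedCell (xl xr yb yt : ℝ) (n : ℕ) : Set (EuclideanSpace ℝ (Fin (n + n))) :=
  {u | Monotone (padEnds xl xr (firstHalf u)) ∧ Monotone (padEnds yb yt (secondHalf u))}

/-- The face of `sortedCell` whose relative interior contains the point `u`. -/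
def sortedFace (xl xr yb yt : ℝ) (u : EuclideanSpace ℝ (Fin (n + n))) :
    Set (EuclideanSpace ℝ (Fin (n + n))) :=
  {v | v ∈ sortedCell xl xr yb yt n ∧
    Function.FactorsThrough (padEnds xl xr (firstHalf v)) (padEnds xl xr (firstHalf u)) ∧
    Function.FactorsThrough (padEnds yb yt (secondHalf v)) (padEnds yb yt (secondHalf u))}

theorem exists_affine_padEnds {m : ℕ} (a b : ℝ) (e : Fin n → Fin m) (i : Fin (n + 2)) :
    ∃ (l : EuclideanSpace ℝ (Fin m) →L[ℝ] ℝ) (c : ℝ), ∀ u,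
      padEnds a b (fun j => u (e j)) i = l u + c := by
  refine forall_fin_padEnds (p := fun i => ∃ (l : EuclideanSpace ℝ (Fin m) →L[ℝ] ℝ) (c : ℝ), ∀ u,
    padEnds a b (fun j => u (e j)) i = l u + c) ?_ ?_ ?_ i
  · exact ⟨0, a, by simp⟩
  · exact ⟨0, b, by simp⟩
  · intro j
    exact ⟨EuclideanSpace.proj (e j), 0, by simp⟩

theorem factorsThrough_of_le {m : ℕ} {X Y : Fin m → ℝ}
    (h : ∀ i j, i ≤ j → X j = X i → Y j = Y i) : Function.FactorsThrough Y X := by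
  intro i j hij
  rcases le_total i j with h' | h'
  · exact (h i j h' hij.symm).symm
  · exact h j i h' hij

theorem exists_polyhedron_sortedCell (xl xr yb yt : ℝ) (n : ℕ) :
    ∃ (κ : Type) (_ : Finite κ) (L : κ → EuclideanSpace ℝ (Fin (n + n)) →L[ℝ] ℝ) (c : κ → ℝ),
      sortedCell xl xr yb yt n = polyhedron L c ∧
      ∀ u, sortedFace xl xr yb yt u = tightFace L c u := by
  choose l₁ c₁ h₁ using exists_affine_padEnds xl xr (Fin.castAdd n : Fin n → Fin (n + n))
  choose l₂ c₂ h₂ using exists_affine_padEnds yb yt (Fin.natAdd n : Fin n → Fin (n + n))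
  -- One inequality for every ordered pair of padded entries, not only for neighbours, so that tight
  -- inequalities correspond directly to equal entries. The constants `c` come from the fixed ends.
  let P := {p : Fin (n + 2) × Fin (n + 2) // p.1 ≤ p.2}
  let L : P ⊕ P → EuclideanSpace ℝ (Fin (n + n)) →L[ℝ] ℝ :=
    Sum.elim (fun p => l₁ p.1.2 - l₁ p.1.1) (fun p => l₂ p.1.2 - l₂ p.1.1)
  let c : P ⊕ P → ℝ := Sum.elim (fun p => c₁ p.1.1 - c₁ p.1.2) (fun p => c₂ p.1.1 - c₂ p.1.2)
  have hX : ∀ u i, padEnds xl xr (firstHalf u) i = l₁ i u + c₁ i := fun u i => h₁ i u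
  have hY : ∀ u i, padEnds yb yt (secondHalf u) i = l₂ i u + c₂ i := fun u i => h₂ i u
  have hP : sortedCell xl xr yb yt n = polyhedron L c := by
    ext u
    constructor
    · rintro ⟨h, h'⟩ (⟨⟨i, j⟩, hij⟩ | ⟨⟨i, j⟩, hij⟩)
      · have := h hij
        rw [hX, hX] at this
        simp only [L, c, Sum.elim_inl, sub_apply]
        linarith
      · have := h' hij
        rw [hY, hY] at this
        simp only [L, c, Sum.elim_inr, sub_apply]
        linarith
    · intro h
      refine ⟨fun i j hij => ?_, fun i j hij => ?_⟩
      · have := h (Sum.inl ⟨(i, j), hij⟩)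
        simp only [L, c, Sum.elim_inl, sub_apply] at this
        rw [hX, hX]
        linarith
      · have := h (Sum.inr ⟨(i, j), hij⟩)
        simp only [L, c, Sum.elim_inr, sub_apply] at this
        rw [hY, hY]
        linarith
  refine ⟨P ⊕ P, inferInstance, L, c, hP, fun u => ?_⟩
  ext v
  refine and_congr (by rw [hP]) ⟨?_, fun h => ⟨?_, ?_⟩⟩
  · rintro ⟨h, h'⟩ (⟨⟨i, j⟩, hij⟩ | ⟨⟨i, j⟩, hij⟩) hk
    · simp only [L, c, Sum.elim_inl, sub_apply] at hk ⊢
      have := @h i j (by rw [hX, hX]; linarith)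
      rw [hX, hX] at this
      linarith
    · simp only [L, c, Sum.elim_inr, sub_apply] at hk ⊢
      have := @h' i j (by rw [hY, hY]; linarith)
      rw [hY, hY] at this
      linarith
  · refine factorsThrough_of_le fun i j hij he => ?_
    have := h (Sum.inl ⟨(i, j), hij⟩)
    simp only [L, c, Sum.elim_inl, sub_apply] at this
    rw [hX, hX] at he ⊢
    linarith [this (by linarith)]
  · refine factorsThrough_of_le fun i j hij he => ?_
    have := h (Sum.inr ⟨(i, j), hij⟩)
    simp only [L, c, Sum.elim_inr, sub_apply] at this
    rw [hY, hY] at he ⊢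
    linarith [this (by linarith)]

theorem isExposed_sortedFace {u : EuclideanSpace ℝ (Fin (n + n))}
    (hu : u ∈ sortedCell xl xr yb yt n) :
    IsExposed ℝ (sortedCell xl xr yb yt n) (sortedFace xl xr yb yt u) := by
  obtain ⟨κ, _, L, c, hP, hF⟩ := exists_polyhedron_sortedCell xl xr yb yt n
  rw [hP] at hu ⊢
  rw [hF]
  exact isExposed_tightFace hu

theorem eq_sortedFace {F : Set (EuclideanSpace ℝ (Fin (n + n)))}
    {u : EuclideanSpace ℝ (Fin (n + n))} (hF : IsExposed ℝ (sortedCell xl xr yb yt n) F)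
    (hu : u ∈ intrinsicInterior ℝ F) : F = sortedFace xl xr yb yt u := by
  obtain ⟨κ, _, L, c, hP, hF'⟩ := exists_polyhedron_sortedCell xl xr yb yt n
  rw [hP] at hF
  rw [hF']
  exact eq_tightFace_of_mem_intrinsicInterior hF hu

theorem mem_intrinsicInterior_sortedFace_iff {u v : EuclideanSpace ℝ (Fin (n + n))}
    (hu : u ∈ sortedCell xl xr yb yt n) :
    v ∈ intrinsicInterior ℝ (sortedFace xl xr yb yt u) ↔
      v ∈ sortedFace xl xr yb yt u ∧ u ∈ sortedFace xl xr yb yt v := by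
  obtain ⟨κ, _, L, c, hP, hF⟩ := exists_polyhedron_sortedCell xl xr yb yt n
  rw [hP] at hu
  rw [hF, hF]
  exact mem_intrinsicInterior_tightFace_iff hu

theorem exists_eq_sortedFace {F : Set (EuclideanSpace ℝ (Fin (n + n)))}
    (hF : IsExposed ℝ (sortedCell xl xr yb yt n) F) (hne : F.Nonempty) :
    ∃ u ∈ sortedCell xl xr yb yt n, F = sortedFace xl xr yb yt u := by
  obtain ⟨κ, _, L, c, hP, hF'⟩ := exists_polyhedron_sortedCell xl xr yb yt n
  rw [hP] at hF ⊢
  simp only [hF']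
  exact hF.exists_eq_tightFace hne

theorem mem_sortedFace_self {u : EuclideanSpace ℝ (Fin (n + n))}
    (hu : u ∈ sortedCell xl xr yb yt n) : u ∈ sortedFace xl xr yb yt u :=
  ⟨hu, fun _ _ h => h, fun _ _ h => h⟩

theorem exists_sortedCell_eq_convexHull (hx : xl < xr) (hy : yb < yt) :
    ∃ s : Finset (EuclideanSpace ℝ (Fin (n + n))), s.Nonempty ∧
      sortedCell xl xr yb yt n = convexHull ℝ (s : Set (EuclideanSpace ℝ (Fin (n + n)))) := by
  have hfin : (joinHalves '' (Set.range (stepTuple xl xr : Fin (n + 1) → Fin n → ℝ) ×ˢ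
      Set.range (stepTuple yb yt : Fin (n + 1) → Fin n → ℝ))).Finite :=
    ((Set.finite_range _).prod (Set.finite_range _)).image _
  refine ⟨hfin.toFinset, ?_, ?_⟩
  · rw [Set.Finite.toFinset_nonempty]
    exact ((Set.range_nonempty _).prod (Set.range_nonempty _)).image _
  · rw [Set.Finite.coe_toFinset, ← LinearMap.image_convexHull, convexHull_prod,
      convexHull_range_stepTuple hx, convexHull_range_stepTuple hy]
    ext u
    constructor
    · intro h
      exact ⟨(firstHalf u, secondHalf u), h, ext_halves (by simp) (by simp)⟩
    · rintro ⟨p, hp, rfl⟩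
      refine ⟨?_, ?_⟩
      · rw [firstHalf_joinHalves]
        exact hp.1
      · rw [secondHalf_joinHalves]
        exact hp.2

end SortedCell

/-! ### Faces are bi-orthoschemes. -/

section FaceShape

variable {n : ℕ}

/-- A face of the simplex of sorted tuples is an isometric copy of an orthoscheme. -/
theorem exists_orthoscheme_face {a b : ℝ} (hab : a < b) {x : Fin n → ℝ}
    (hx : Monotone (padEnds a b x)) :
    ∃ (d : ℕ) (A : Set (EuclideanSpace ℝ (Fin d))) (ψ : EuclideanSpace ℝ (Fin d) → Fin n → ℝ),
      IsOrthoscheme d A ∧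
      ψ '' A = {x' | Monotone (padEnds a b x') ∧
        Function.FactorsThrough (padEnds a b x') (padEnds a b x)} ∧
      ∀ c c', ∑ i, (ψ c i - ψ c' i) ^ 2 = dist c c' ^ 2 := by
  classical
  obtain ⟨d, g, r, H⟩ := exists_isSortedGrid hab hx
  let S : Fin d → Finset (Fin n) := fun j =>
    Finset.univ.filter fun t => r t.castSucc.succ = j.castSucc.succ
  -- A change of the `j`-th internal grid value moves `(S j).card` coordinates by the same amount,
  -- hence the square root as scale factor.
  let w : Fin d → ℝ := fun j => √(S j).card
  have hw : ∀ j, w j ≠ 0 := by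
    intro j
    obtain ⟨t, ht⟩ := exists_inner_eq H.monotone H.surjective j.castSucc.succ (Fin.succ_ne_zero _)
      (by rw [← Fin.succ_last, Ne, Fin.succ_inj]; exact (Fin.castSucc_lt_last j).ne)
    have : 0 < (S j).card := Finset.card_pos.2 ⟨t, by simpa [S] using ht⟩
    exact (Real.sqrt_pos.2 (by exact_mod_cast this)).ne'
  let ψ : EuclideanSpace ℝ (Fin d) → Fin n → ℝ := fun c t =>
    padEnds a b (fun j => c j / w j) (r t.castSucc.succ)
  have hψ : ∀ c, padEnds a b (ψ c) = padEnds a b (fun j => c j / w j) ∘ r := by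
    intro c
    refine eq_padEnds (X := padEnds a b (fun j => c j / w j) ∘ r) ?_ ?_
    · rw [Function.comp_apply, Fin.map_zero_of_monotone_surjective H.monotone H.surjective,
        padEnds_zero]
    · rw [Function.comp_apply, Fin.map_last_of_monotone_surjective H.monotone H.surjective,
        padEnds_last]
  refine ⟨d, scaleTuple w '' {x | Monotone (padEnds a b x)}, ψ,
    isOrthoscheme_image_scaleTuple hab hw, ?_, ?_⟩
  · ext x'
    constructor
    · rintro ⟨_, ⟨t, ht, rfl⟩, rfl⟩
      have h1 : padEnds a b (ψ (scaleTuple w t)) = padEnds a b t ∘ r := by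
        rw [hψ]
        congr 2
        funext j
        rw [scaleTuple_apply, mul_div_cancel_left₀ _ (hw j)]
      refine ⟨?_, ?_⟩
      · rw [h1]
        exact Monotone.comp ht H.monotone
      · rw [h1]
        intro i j hij
        rw [H.eq] at hij
        simp [H.strictMono.injective hij]
    · rintro ⟨hm, hf⟩
      -- A tuple of the face is constant on the fibres of `r`, so its values at a section of `r`
      -- recover it.
      obtain ⟨s, hs⟩ := H.surjective.hasRightInverse
      have hX : padEnds a b x' ∘ s ∘ r = padEnds a b x' := by
        funext i
        refine hf ?_
        rw [H.eq, Function.comp_apply, Function.comp_apply, Function.comp_apply, hs]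
      have hmono : Monotone (padEnds a b x' ∘ s) := by
        intro i j hij
        rcases le_total (s i) (s j) with h | h
        · exact hm h
        · have h1 := H.monotone h
          rw [hs, hs] at h1
          rw [le_antisymm hij h1]
      have hpad : padEnds a b (fun j : Fin d => (padEnds a b x' ∘ s) j.castSucc.succ) =
          padEnds a b x' ∘ s := by
        refine eq_padEnds (X := padEnds a b x' ∘ s) ?_ ?_
        · have := congrFun hX 0
          simpa [Fin.map_zero_of_monotone_surjective H.monotone H.surjective] using this
        · have := congrFun hX (Fin.last _)
          simpa [Fin.map_last_of_monotone_surjective H.monotone H.surjective] using this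
      refine ⟨_, ⟨fun j : Fin d => (padEnds a b x' ∘ s) j.castSucc.succ, ?_, rfl⟩, ?_⟩
      · change Monotone (padEnds a b _)
        rw [hpad]
        exact hmono
      · funext t
        have h1 : (fun j => scaleTuple w (fun j : Fin d => (padEnds a b x' ∘ s) j.castSucc.succ) j
            / w j) = fun j : Fin d => (padEnds a b x' ∘ s) j.castSucc.succ := by
          funext j
          rw [scaleTuple_apply, mul_div_cancel_left₀ _ (hw j)]
        change padEnds a b _ (r t.castSucc.succ) = _
        rw [h1, hpad]
        have := congrFun hX t.castSucc.succ
        rwa [padEnds_inner] at this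
  · intro c c'
    rw [EuclideanSpace.dist_eq, Real.sq_sqrt (Finset.sum_nonneg fun _ _ => sq_nonneg _)]
    have h1 := Finset.sum_fiberwise (s := (Finset.univ : Finset (Fin n)))
      (fun t => r t.castSucc.succ) (fun t => (ψ c t - ψ c' t) ^ 2)
    have h2 : ∀ i : Fin (d + 2), ∑ t with r t.castSucc.succ = i, (ψ c t - ψ c' t) ^ 2 =
        (Finset.univ.filter fun t : Fin n => r t.castSucc.succ = i).card *
          (padEnds a b (fun j => c j / w j) i - padEnds a b (fun j => c' j / w j) i) ^ 2 := by
      intro i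
      rw [Finset.sum_congr rfl (g := fun _ =>
        (padEnds a b (fun j => c j / w j) i - padEnds a b (fun j => c' j / w j) i) ^ 2)]
      · simp
      · intro t ht
        simp only [ψ, (Finset.mem_filter.1 ht).2]
    rw [← h1]
    simp only [h2]
    -- The two end fibres have fixed values and contribute nothing.
    rw [Fin.sum_univ_succ, Fin.sum_univ_castSucc]
    simp only [Fin.succ_last, padEnds_zero, padEnds_last, padEnds_inner, sub_self, ne_eq,
      OfNat.ofNat_ne_zero, not_false_eq_true, zero_pow, mul_zero, zero_add, add_zero]
    refine Finset.sum_congr rfl fun j _ => ?_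
    have h3 : w j ^ 2 = (S j).card := Real.sq_sqrt (by positivity)
    rw [Real.dist_eq, sq_abs]
    change ((S j).card : ℝ) * _ = _
    rw [← h3]
    have := hw j
    field_simp

variable {xl xr yb yt : ℝ}

theorem isBiOrthoscheme_sortedFace (hx : xl < xr) (hy : yb < yt)
    {u : EuclideanSpace ℝ (Fin (n + n))} (hu : u ∈ sortedCell xl xr yb yt n) :
    IsBiOrthoscheme (sortedFace xl xr yb yt u) := by
  obtain ⟨d, A, ψ, hA, hψ, hd⟩ := exists_orthoscheme_face hx hu.1
  obtain ⟨e, B, χ, hB, hχ, he⟩ := exists_orthoscheme_face hy hu.2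
  refine ⟨d, e, A, B, hA, hB, ?_⟩
  let W := {w : WithLp 2 (EuclideanSpace ℝ (Fin d) × EuclideanSpace ℝ (Fin e)) |
      w.fst ∈ A ∧ w.snd ∈ B}
  have hmem : ∀ w : W, joinHalves (ψ w.1.fst, χ w.1.snd) ∈ sortedFace xl xr yb yt u := by
    intro w
    have h1 : ψ w.1.fst ∈ ψ '' A := ⟨_, w.2.1, rfl⟩
    have h2 : χ w.1.snd ∈ χ '' B := ⟨_, w.2.2, rfl⟩
    rw [hψ] at h1
    rw [hχ] at h2
    refine ⟨⟨?_, ?_⟩, ?_, ?_⟩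
    · rw [firstHalf_joinHalves]; exact h1.1
    · rw [secondHalf_joinHalves]; exact h2.1
    · rw [firstHalf_joinHalves]; exact h1.2
    · rw [secondHalf_joinHalves]; exact h2.2
  let Φ : W → sortedFace xl xr yb yt u := fun w => ⟨joinHalves (ψ w.1.fst, χ w.1.snd), hmem w⟩
  have hiso : Isometry Φ := by
    refine Isometry.of_dist_eq fun w w' => ?_
    change dist (joinHalves (ψ w.1.fst, χ w.1.snd)) (joinHalves (ψ w'.1.fst, χ w'.1.snd)) =
      dist w.1 w'.1
    rw [dist_eq_sqrt_halves, WithLp.prod_dist_eq_of_L2]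
    simp only [firstHalf_joinHalves, secondHalf_joinHalves]
    rw [hd, he]
  have hsurj : Function.Surjective Φ := by
    rintro ⟨v, hv⟩
    have h1 : firstHalf v ∈ ψ '' A := by rw [hψ]; exact ⟨hv.1.1, hv.2.1⟩
    have h2 : secondHalf v ∈ χ '' B := by rw [hχ]; exact ⟨hv.1.2, hv.2.2⟩
    obtain ⟨p, hp, hp'⟩ := h1
    obtain ⟨q, hq, hq'⟩ := h2
    refine ⟨⟨WithLp.toLp 2 (p, q), hp, hq⟩, Subtype.ext (ext_halves ?_ ?_)⟩
    · change firstHalf (joinHalves (ψ p, χ q)) = _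
      rw [firstHalf_joinHalves, hp']
    · change secondHalf (joinHalves (ψ p, χ q)) = _
      rw [secondHalf_joinHalves, hq']
  exact ⟨(IsometryEquiv.mk (Equiv.ofBijective Φ ⟨hiso.injective, hsurj⟩) hiso).symm⟩

end FaceShape

/-! ### Crossings of coordinates along a segment of tuples. -/

section Discordance

variable {n : ℕ}

open scoped Classical in
/-- The pairs of indices at which two tuples have strictly opposite order. -/
noncomputable def discordant (x y : Fin n → ℝ) : Finset (Fin n × Fin n) :=
  Finset.univ.filter fun p => (x p.1 - x p.2) * (y p.1 - y p.2) < 0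

theorem mem_discordant {x y : Fin n → ℝ} {p : Fin n × Fin n} :
    p ∈ discordant x y ↔ (x p.1 - x p.2) * (y p.1 - y p.2) < 0 := by
  simp [discordant]

theorem discordant_comm (x y : Fin n → ℝ) : discordant x y = discordant y x := by
  ext p
  rw [mem_discordant, mem_discordant, mul_comm]

/-- The point dividing the segment from `x` to `y` in the ratio `t : 1 - t`. -/
def between (t : ℝ) (x y : Fin n → ℝ) : Fin n → ℝ := fun i => (1 - t) * x i + t * y i

theorem between_comm (t : ℝ) (x y : Fin n → ℝ) : between t x y = between (1 - t) y x := by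
  funext i
  simp only [between]
  ring

theorem discordant_between_subset {x y : Fin n → ℝ} {t : ℝ} (h0 : 0 < t) (h1 : t < 1) :
    discordant x (between t x y) ⊆ discordant x y := by
  intro p hp
  rw [mem_discordant] at hp ⊢
  simp only [between] at hp
  have h2 : t * ((x p.1 - x p.2) * (y p.1 - y p.2)) < 0 := by
    nlinarith [mul_nonneg (sub_pos.2 h1).le (sq_nonneg (x p.1 - x p.2))]
  exact (pos_iff_neg_of_mul_neg h2).1 h0

theorem discordant_between_subset' {x y : Fin n → ℝ} {t : ℝ} (h0 : 0 < t) (h1 : t < 1) :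
    discordant (between t x y) y ⊆ discordant x y := by
  rw [discordant_comm _ y, between_comm, discordant_comm x y]
  exact discordant_between_subset (sub_pos.2 h1) (by linarith)

/-- Cut the segment at the time `c / (c - d)` when the two entries of a discordant pair coincide.
This pair is then discordant on neither piece, and no new discordant pair arises. -/
theorem exists_between_discordant_ssubset {x y : Fin n → ℝ} (h : (discordant x y).Nonempty) :
    ∃ t : ℝ, 0 < t ∧ t < 1 ∧ discordant x (between t x y) ⊂ discordant x y ∧
      discordant (between t x y) y ⊂ discordant x y := by
  obtain ⟨p, hp⟩ := h
  have hp' := mem_discordant.1 hp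
  set c := x p.1 - x p.2 with hc
  set d := y p.1 - y p.2 with hd
  have hcd : c - d ≠ 0 := by
    intro h
    rw [sub_eq_zero.1 h] at hp'
    nlinarith [mul_self_nonneg d]
  have ht : 0 < c / (c - d) ∧ c / (c - d) < 1 := by
    rcases mul_neg_iff.1 hp' with ⟨h1, h2⟩ | ⟨h1, h2⟩
    · exact ⟨div_pos h1 (by linarith), (div_lt_one (by linarith)).2 (by linarith)⟩
    · exact ⟨div_pos_of_neg_of_neg h1 (by linarith),
        (div_lt_one_of_neg (by linarith)).2 (by linarith)⟩
  have hz : between (c / (c - d)) x y p.1 - between (c / (c - d)) x y p.2 = 0 := by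
    have : between (c / (c - d)) x y p.1 - between (c / (c - d)) x y p.2 =
        c - c / (c - d) * (c - d) := by
      simp only [between, hc, hd]
      ring
    rw [this, div_mul_cancel₀ _ hcd, sub_self]
  refine ⟨c / (c - d), ht.1, ht.2, ?_, ?_⟩
  · refine (Finset.ssubset_iff_of_subset (discordant_between_subset ht.1 ht.2)).2 ⟨p, hp, ?_⟩
    rw [mem_discordant, hz]
    simp
  · refine (Finset.ssubset_iff_of_subset (discordant_between_subset' ht.1 ht.2)).2 ⟨p, hp, ?_⟩
    rw [mem_discordant, hz]
    simp

theorem exists_common_sort {x y : Fin n → ℝ} (h : discordant x y = ∅) :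
    ∃ π : Equiv.Perm (Fin n), Monotone (x ∘ π) ∧ Monotone (y ∘ π) := by
  have hno : ∀ i j, 0 ≤ (x i - x j) * (y i - y j) := fun i j => by
    by_contra hlt
    have : (i, j) ∈ discordant x y := mem_discordant.2 (not_le.1 hlt)
    rw [h] at this
    simp at this
  -- Without discordant pairs the differences in `x` and `y` never have opposite signs, so sorting
  -- the sum sorts both.
  refine ⟨Tuple.sort (x + y), fun i j hij => ?_, fun i j hij => ?_⟩
  all_goals
    have h1 := Tuple.monotone_sort (x + y) hij
    have h2 := hno (Tuple.sort (x + y) i) (Tuple.sort (x + y) j)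
    simp only [Function.comp, Pi.add_apply] at h1 ⊢
    by_contra hlt
    rw [not_le] at hlt
    nlinarith

end Discordance

/-! ### Distances of multisets in terms of coordinates. -/

section Distance

variable {n : ℕ} {xl xr yb yt : ℝ}

/-- The distance of two pairs of tuples. -/
noncomputable def pairDist (x y x' y' : Fin n → ℝ) : ℝ :=
  √(∑ i, (x i - x' i) ^ 2 + ∑ i, (y i - y' i) ^ 2)

theorem pairDist_comp (x y x' y' : Fin n → ℝ) (π ρ : Equiv.Perm (Fin n)) :
    pairDist (x ∘ π) (y ∘ ρ) (x' ∘ π) (y' ∘ ρ) = pairDist x y x' y' := by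
  simp only [pairDist, Function.comp]
  rw [Equiv.sum_comp π (fun i => (x i - x' i) ^ 2), Equiv.sum_comp ρ (fun i => (y i - y' i) ^ 2)]

theorem pairDist_between_left (x y x' y' : Fin n → ℝ) {t : ℝ} (ht : 0 ≤ t) :
    pairDist x y (between t x x') (between t y y') = t * pairDist x y x' y' := by
  have h1 : ∀ x x' : Fin n → ℝ, ∑ i, (x i - between t x x' i) ^ 2 =
      t ^ 2 * ∑ i, (x i - x' i) ^ 2 := by
    intro x x'
    rw [Finset.mul_sum]
    refine Finset.sum_congr rfl fun i _ => ?_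
    simp only [between]
    ring
  rw [pairDist, h1, h1, ← mul_add, Real.sqrt_mul (sq_nonneg t), Real.sqrt_sq ht, pairDist]

theorem pairDist_comm (x y x' y' : Fin n → ℝ) : pairDist x y x' y' = pairDist x' y' x y := by
  simp only [pairDist]
  congr 2 <;> exact Finset.sum_congr rfl fun i _ => by ring

theorem pairDist_between_right (x y x' y' : Fin n → ℝ) {t : ℝ} (ht : t ≤ 1) :
    pairDist (between t x x') (between t y y') x' y' = (1 - t) * pairDist x y x' y' := by
  rw [pairDist_comm, between_comm t x, between_comm t y,
    pairDist_between_left _ _ _ _ (sub_nonneg.2 ht), pairDist_comm]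

theorem tupleDist_eq_pairDist (z w : Fin n → coordRect xl xr yb yt) :
    Mult.tupleDist z w = pairDist (fun t => (z t : ℂ).re) (fun t => (z t : ℂ).im)
      (fun t => (w t : ℂ).re) (fun t => (w t : ℂ).im) := by
  have h2 : 0 < (2 : ℝ≥0∞).toReal := by norm_num
  rw [Mult.tupleDist, PiLp.dist_eq_sum h2, pairDist, Real.sqrt_eq_rpow, ← Finset.sum_add_distrib]
  simp only [ENNReal.toReal_ofNat, Real.rpow_two]
  congr 1
  refine Finset.sum_congr rfl fun t _ => ?_
  rw [Subtype.dist_eq, Complex.dist_eq_re_im, Real.sq_sqrt (by positivity)]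

theorem dist_multOfCoords_le (x y x' y' : Fin n → ℝ) (hx : ∀ t, x t ∈ Set.Icc xl xr)
    (hy : ∀ t, y t ∈ Set.Icc yb yt) (hx' : ∀ t, x' t ∈ Set.Icc xl xr)
    (hy' : ∀ t, y' t ∈ Set.Icc yb yt) :
    dist (multOfCoords x y hx hy) (multOfCoords x' y' hx' hy') ≤ pairDist x y x' y' := by
  refine (Mult.orbitDist_le _ _ 1).trans (le_of_eq ?_)
  rw [tupleDist_eq_pairDist]
  rfl

theorem exists_pairDist_eq_dist (z w : Mult n (coordRect xl xr yb yt)) :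
    ∃ (x y x' y' : Fin n → ℝ) (hx : ∀ t, x t ∈ Set.Icc xl xr) (hy : ∀ t, y t ∈ Set.Icc yb yt)
      (hx' : ∀ t, x' t ∈ Set.Icc xl xr) (hy' : ∀ t, y' t ∈ Set.Icc yb yt),
      z = multOfCoords x y hx hy ∧ w = multOfCoords x' y' hx' hy' ∧
      dist z w = pairDist x y x' y' := by
  obtain ⟨z, rfl⟩ := Quotient.exists_rep z
  obtain ⟨w, rfl⟩ := Quotient.exists_rep w
  obtain ⟨σ, hσ⟩ := Mult.exists_orbitDist_eq z w
  refine ⟨fun t => (z t : ℂ).re, fun t => (z t : ℂ).im, fun t => (w (σ t) : ℂ).re,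
    fun t => (w (σ t) : ℂ).im, fun t => (z t).2.1, fun t => (z t).2.2, fun t => (w (σ t)).2.1,
    fun t => (w (σ t)).2.2, rfl, ?_, ?_⟩
  · exact Quotient.sound (s := permSetoid n _) ⟨σ⁻¹, by funext t; ext; simp⟩
  · change Mult.orbitDist z w = _
    rw [← hσ, tupleDist_eq_pairDist]
    rfl

end Distance

/-! ### The complex and its isometry with the multiset space. -/

section Complex

variable {n : ℕ} {xl xr yb yt : ℝ}

/-- The map from the polytope of sorted tuples to the multiset space that matches the real parts
with the imaginary parts according to `σ`. -/
def cellMap (σ : Equiv.Perm (Fin n)) (u : sortedCell xl xr yb yt n) :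
    Mult n (coordRect xl xr yb yt) :=
  multOfCoords (firstHalf u.1) (secondHalf u.1 ∘ σ) (monotone_padEnds_mem u.2.1)
    (fun t => monotone_padEnds_mem u.2.2 (σ t))

theorem dist_cellMap_le (σ : Equiv.Perm (Fin n)) (u v : sortedCell xl xr yb yt n) :
    dist (cellMap σ u) (cellMap σ v) ≤ dist u v := by
  rw [Subtype.dist_eq, dist_eq_sqrt_halves]
  have h := dist_multOfCoords_le (firstHalf u.1) (secondHalf u.1 ∘ σ) (firstHalf v.1)
    (secondHalf v.1 ∘ σ) (monotone_padEnds_mem u.2.1) (fun t => monotone_padEnds_mem u.2.2 (σ t))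
    (monotone_padEnds_mem v.2.1) (fun t => monotone_padEnds_mem v.2.2 (σ t))
  have h' := pairDist_comp (firstHalf u.1) (secondHalf u.1) (firstHalf v.1) (secondHalf v.1) 1 σ
  rw [Equiv.Perm.coe_one, Function.comp_id, Function.comp_id] at h'
  exact h.trans h'.le

/-- Each half is the sorted list of the real or imaginary parts of the multiset, and sorted
rearrangements are unique. This is why points are only ever glued to points with the same
coordinates. -/
theorem eq_of_cellMap_eq {σ τ : Equiv.Perm (Fin n)} {u v : sortedCell xl xr yb yt n}
    (h : cellMap σ u = cellMap τ v) : u = v := by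
  obtain ⟨π, h1, h2⟩ := multOfCoords_eq_iff.1 h
  refine Subtype.ext (ext_halves ?_ ?_)
  · have := Tuple.unique_monotone (f := firstHalf v.1) (σ := π) (τ := 1)
      (by rw [← h1]; exact monotone_of_monotone_padEnds u.2.1)
      (monotone_of_monotone_padEnds v.2.1)
    rw [h1, this]
    rfl
  · have h3 : secondHalf u.1 = secondHalf v.1 ∘ ⇑(τ * π * σ⁻¹) := by
      funext t
      simpa using congrFun h2 (σ⁻¹ t)
    have := Tuple.unique_monotone (f := secondHalf v.1) (σ := τ * π * σ⁻¹) (τ := 1)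
      (by rw [← h3]; exact monotone_of_monotone_padEnds u.2.2)
      (monotone_of_monotone_padEnds v.2.2)
    rw [h3, this]
    rfl

/-- The permutation `π` identifying the two images of `u` only uses equalities among coordinates of
`u`. They persist at `v`, so the same `π` works. -/
theorem cellMap_eq_of_mem_sortedFace {σ τ : Equiv.Perm (Fin n)} {u v : sortedCell xl xr yb yt n}
    (h : cellMap σ u = cellMap τ u) (hv : v.1 ∈ sortedFace xl xr yb yt u.1) :
    cellMap σ v = cellMap τ v := by
  obtain ⟨π, h1, h2⟩ := multOfCoords_eq_iff.1 h
  obtain ⟨-, hf, hf'⟩ := hv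
  refine multOfCoords_eq_iff.2 ⟨π, funext fun t => ?_, funext fun t => ?_⟩
  · have := @hf t.castSucc.succ (π t).castSucc.succ (by simpa using congrFun h1 t)
    simpa using this
  · have := @hf' (σ t).castSucc.succ (τ (π t)).castSucc.succ
      (by simpa using congrFun h2 t)
    simpa using this

/-- The complex of multisets in a rectangle: one polytope of pairs of sorted tuples for each way to
match real parts with imaginary parts. -/
def multComplex (n : ℕ) (hx : xl < xr) (hy : yb < yt) : EuclideanComplex where
  ι := Equiv.Perm (Fin n)
  dim _ := n + n
  cell _ := sortedCell xl xr yb yt n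
  polytope _ := exists_sortedCell_eq_convexHull hx hy
  rel := Setoid.ker fun p => cellMap p.1 p.2
  inj _ _ _ _ _ _ _ h := eq_of_cellMap_eq h
  glue σ τ F G hF hG u v hu hv h := by
    have h : cellMap σ u = cellMap τ v := h
    obtain rfl := eq_of_cellMap_eq h
    have hF' := eq_sortedFace hF hu
    obtain rfl : F = G := hF'.trans (eq_sortedFace hG hv).symm
    refine ⟨IsometryEquiv.refl F, fun y => ?_⟩
    exact cellMap_eq_of_mem_sortedFace (v := ⟨y, hF.subset y.2⟩) h (hF' ▸ y.2)

variable (n) (hx : xl < xr) (hy : yb < yt)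

/-- The bijection from the complex to the multiset space. -/
def multComplexMap : (multComplex n hx hy).Space → Mult n (coordRect xl xr yb yt) :=
  Quotient.lift (s := (multComplex n hx hy).rel) (fun p => cellMap p.1 p.2) fun _ _ h => h

variable {n}

theorem multComplexMap_injective : Function.Injective (multComplexMap n hx hy) := by
  rintro ⟨p⟩ ⟨q⟩ h
  exact Quotient.sound (s := (multComplex n hx hy).rel) h

theorem exists_cellMap_eq (hx : xl < xr) (hy : yb < yt) (z : Mult n (coordRect xl xr yb yt)) :
    ∃ σ u, cellMap (xl := xl) (xr := xr) (yb := yb) (yt := yt) σ u = z := by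
  obtain ⟨x, y, σ, h, h', rfl⟩ := exists_eq_multOfCoords_sorted hx hy z
  refine ⟨σ, ⟨joinHalves (x, y), ?_, ?_⟩, ?_⟩
  · rwa [firstHalf_joinHalves]
  · rwa [secondHalf_joinHalves]
  · exact multOfCoords_eq_iff.2 ⟨1, by simp, by simp⟩

theorem multComplexMap_surjective : Function.Surjective (multComplexMap n hx hy) := by
  intro z
  obtain ⟨σ, u, rfl⟩ := exists_cellMap_eq hx hy z
  exact ⟨(multComplex n hx hy).pt σ u, rfl⟩

theorem edist_multComplexMap_le {p q : (multComplex n hx hy).Space} {L : ℝ≥0∞}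
    (h : (multComplex n hx hy).StringLength p q L) :
    edist (multComplexMap n hx hy p) (multComplexMap n hx hy q) ≤ L := by
  induction h with
  | refl x => simp
  | step σ u v _ ih =>
    refine (edist_triangle _ (multComplexMap n hx hy ((multComplex n hx hy).pt σ v)) _).trans
      (add_le_add ?_ ih)
    rw [edist_dist, edist_dist]
    exact ENNReal.ofReal_le_ofReal (dist_cellMap_le σ u v)

theorem exists_cellMap_eq_of_discordant_eq_empty (hx : xl < xr) (hy : yb < yt)
    {x y x' y' : Fin n → ℝ}
    (hmx : ∀ t, x t ∈ Set.Icc xl xr) (hmy : ∀ t, y t ∈ Set.Icc yb yt)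
    (hmx' : ∀ t, x' t ∈ Set.Icc xl xr) (hmy' : ∀ t, y' t ∈ Set.Icc yb yt)
    (h1 : discordant x x' = ∅) (h2 : discordant y y' = ∅) :
    ∃ (σ : Equiv.Perm (Fin n)) (u v : sortedCell xl xr yb yt n),
      cellMap σ u = multOfCoords x y hmx hmy ∧ cellMap σ v = multOfCoords x' y' hmx' hmy' ∧
      dist u v = pairDist x y x' y' := by
  obtain ⟨π, hπ, hπ'⟩ := exists_common_sort h1
  obtain ⟨ρ, hρ, hρ'⟩ := exists_common_sort h2
  have hmem : ∀ x y : Fin n → ℝ, Monotone (x ∘ π) → Monotone (y ∘ ρ) →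
      (∀ t, x t ∈ Set.Icc xl xr) → (∀ t, y t ∈ Set.Icc yb yt) →
      joinHalves (x ∘ π, y ∘ ρ) ∈ sortedCell xl xr yb yt n := by
    intro x y h1 h2 h3 h4
    refine ⟨?_, ?_⟩
    · rw [firstHalf_joinHalves]
      exact monotone_padEnds hx.le h1 fun t => h3 _
    · rw [secondHalf_joinHalves]
      exact monotone_padEnds hy.le h2 fun t => h4 _
  -- If `π` sorts both tuples of real parts and `ρ` both tuples of imaginary parts, the sorted
  -- tuples are matched by `ρ⁻¹ * π`, so both multisets lie in that polytope.
  refine ⟨ρ⁻¹ * π, ⟨_, hmem x y hπ hρ hmx hmy⟩, ⟨_, hmem x' y' hπ' hρ' hmx' hmy'⟩, ?_, ?_, ?_⟩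
  · refine multOfCoords_eq_iff.2 ⟨π, by simp, ?_⟩
    funext t
    simp
  · refine multOfCoords_eq_iff.2 ⟨π, by simp, ?_⟩
    funext t
    simp
  · rw [Subtype.dist_eq, dist_eq_sqrt_halves]
    simp only [firstHalf_joinHalves, secondHalf_joinHalves]
    exact pairDist_comp x y x' y' π ρ

theorem between_mem_Icc {a b t : ℝ} (h0 : 0 < t) (h1 : t < 1) {x x' : Fin n → ℝ}
    (hx : ∀ i, x i ∈ Set.Icc a b) (hx' : ∀ i, x' i ∈ Set.Icc a b) (i : Fin n) :
    between t x x' i ∈ Set.Icc a b :=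
  (convex_Icc a b) (hx i) (hx' i) (sub_pos.2 h1).le h0.le (by ring)

/-- Induction on the number of discordant pairs. With none, both points lie in one polytope at
distance `pairDist`; otherwise the segment is cut at a crossing, and the lengths of the two pieces
are the fractions `t` and `1 - t` of the whole. -/
theorem edist_le_ofReal_pairDist (N : ℕ) (x y x' y' : Fin n → ℝ)
    (hmx : ∀ t, x t ∈ Set.Icc xl xr) (hmy : ∀ t, y t ∈ Set.Icc yb yt)
    (hmx' : ∀ t, x' t ∈ Set.Icc xl xr) (hmy' : ∀ t, y' t ∈ Set.Icc yb yt)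
    (hN : (discordant x x').card + (discordant y y').card = N)
    (p q : (multComplex n hx hy).Space)
    (hp : multComplexMap n hx hy p = multOfCoords x y hmx hmy)
    (hq : multComplexMap n hx hy q = multOfCoords x' y' hmx' hmy') :
    edist p q ≤ ENNReal.ofReal (pairDist x y x' y') := by
  induction N using Nat.strong_induction_on generalizing x y x' y' p q with
  | _ N ih =>
  by_cases hempty : discordant x x' = ∅ ∧ discordant y y' = ∅
  · obtain ⟨σ, u, v, hu, hv, hd⟩ := exists_cellMap_eq_of_discordant_eq_empty hx hy hmx hmy hmx' hmy'
      hempty.1 hempty.2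
    obtain rfl : (multComplex n hx hy).pt σ u = p :=
      multComplexMap_injective hx hy (by rw [hp, ← hu]; rfl)
    obtain rfl : (multComplex n hx hy).pt σ v = q :=
      multComplexMap_injective hx hy (by rw [hq, ← hv]; rfl)
    refine (iInf₂_le _ (EuclideanComplex.StringLength.step (K := multComplex n hx hy) σ u v
      (EuclideanComplex.StringLength.refl _))).trans (le_of_eq ?_)
    rw [add_zero, ← hd]
    exact edist_dist u v
  · obtain ⟨t, h0, h1, hl, hr⟩ : ∃ t : ℝ, 0 < t ∧ t < 1 ∧
        (discordant x (between t x x')).card + (discordant y (between t y y')).card < N ∧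
        (discordant (between t x x') x').card + (discordant (between t y y') y').card < N := by
      rcases not_and_or.1 hempty with h | h
      · obtain ⟨t, h0, h1, hl, hr⟩ := exists_between_discordant_ssubset
          (Finset.nonempty_iff_ne_empty.2 h)
        refine ⟨t, h0, h1, hN ▸ ?_, hN ▸ ?_⟩
        · exact add_lt_add_of_lt_of_le (Finset.card_lt_card hl)
            (Finset.card_le_card (discordant_between_subset h0 h1))
        · exact add_lt_add_of_lt_of_le (Finset.card_lt_card hr)
            (Finset.card_le_card (discordant_between_subset' h0 h1))
      · obtain ⟨t, h0, h1, hl, hr⟩ := exists_between_discordant_ssubset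
          (Finset.nonempty_iff_ne_empty.2 h)
        refine ⟨t, h0, h1, hN ▸ ?_, hN ▸ ?_⟩
        · exact add_lt_add_of_le_of_lt (Finset.card_le_card (discordant_between_subset h0 h1))
            (Finset.card_lt_card hl)
        · exact add_lt_add_of_le_of_lt (Finset.card_le_card (discordant_between_subset' h0 h1))
            (Finset.card_lt_card hr)
    have hbx := between_mem_Icc h0 h1 hmx hmx'
    have hby := between_mem_Icc h0 h1 hmy hmy'
    obtain ⟨m, hm⟩ := multComplexMap_surjective hx hy (multOfCoords _ _ hbx hby)
    have e1 := ih _ hl x y _ _ hmx hmy hbx hby rfl p m hp hm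
    have e2 := ih _ hr _ _ x' y' hbx hby hmx' hmy' rfl m q hm hq
    refine (edist_triangle p m q).trans ((add_le_add e1 e2).trans (le_of_eq ?_))
    rw [pairDist_between_left _ _ _ _ h0.le, pairDist_between_right _ _ _ _ h1.le,
      ← ENNReal.ofReal_add]
    · congr 1
      ring
    · exact mul_nonneg h0.le (Real.sqrt_nonneg _)
    · exact mul_nonneg (sub_pos.2 h1).le (Real.sqrt_nonneg _)

theorem isometry_multComplexMap : Isometry (multComplexMap n hx hy) := by
  intro p q
  refine le_antisymm (le_iInf₂ fun L hL => edist_multComplexMap_le hx hy hL) ?_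
  obtain ⟨x, y, x', y', hmx, hmy, hmx', hmy', h1, h2, h3⟩ :=
    exists_pairDist_eq_dist (multComplexMap n hx hy p) (multComplexMap n hx hy q)
  rw [edist_dist, h3]
  exact edist_le_ofReal_pairDist hx hy _ x y x' y' hmx hmy hmx' hmy' rfl p q h1 h2

/-- The isometry from the complex onto the multiset space. -/
noncomputable def multComplexIso : (multComplex n hx hy).Space ≃ᵢ Mult n (coordRect xl xr yb yt) :=
  ⟨Equiv.ofBijective (multComplexMap n hx hy)
    ⟨multComplexMap_injective hx hy, multComplexMap_surjective hx hy⟩,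
    isometry_multComplexMap hx hy⟩

end Complex

/-! ### Cells, their relative interiors and the face poset. -/

section FacePoset

variable {n : ℕ} {xl xr yb yt : ℝ} (hx : xl < xr) (hy : yb < yt)

/-- The composition of a multiset in a rectangle. -/
noncomputable def multComp (z : Mult n (coordRect xl xr yb yt)) : RectComp n :=
  (exists_isMultiplicityMatrix hx hy z).choose

theorem isMultiplicityMatrix_multComp (z : Mult n (coordRect xl xr yb yt)) :
    IsMultiplicityMatrix xl xr yb yt z (multComp hx hy z) :=
  (exists_isMultiplicityMatrix hx hy z).choose_spec

theorem isMultiplicityMatrix_iff_multComp_eq {z : Mult n (coordRect xl xr yb yt)}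
    {a : RectComp n} : IsMultiplicityMatrix xl xr yb yt z a ↔ multComp hx hy z = a :=
  ⟨fun h => (isMultiplicityMatrix_multComp hx hy z).unique hx hy h,
    fun h => h ▸ isMultiplicityMatrix_multComp hx hy z⟩

theorem exists_multComp_eq (a : RectComp n) :
    ∃ p : (multComplex n hx hy).Space, multComp hx hy (multComplexMap n hx hy p) = a := by
  obtain ⟨z, hz⟩ := exists_isMultiplicityMatrix_of_rectComp hx hy a
  obtain ⟨p, rfl⟩ := multComplexMap_surjective hx hy z
  exact ⟨p, (isMultiplicityMatrix_iff_multComp_eq hx hy).1 hz⟩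

theorem exists_mem_sortedFace_iff (σ : Equiv.Perm (Fin n)) (u : sortedCell xl xr yb yt n)
    (w : Mult n (coordRect xl xr yb yt)) :
    (∃ v : sortedCell xl xr yb yt n, v.1 ∈ sortedFace xl xr yb yt u.1 ∧ cellMap σ v = w) ↔
      multComp hx hy w ≤ multComp hx hy (cellMap σ u) := by
  rw [← exists_collapse_iff hx hy σ u.2.1 u.2.2 (isMultiplicityMatrix_multComp hx hy w)
    (isMultiplicityMatrix_multComp hx hy (cellMap σ u))]
  constructor
  · rintro ⟨v, hv, rfl⟩
    exact ⟨firstHalf v.1, secondHalf v.1, v.2.1, v.2.2, hv.2.1, hv.2.2, rfl⟩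
  · rintro ⟨x', y', k, k', f, f', rfl⟩
    have hmem : joinHalves (x', y') ∈ sortedCell xl xr yb yt n := by
      refine ⟨?_, ?_⟩
      · rwa [firstHalf_joinHalves]
      · rwa [secondHalf_joinHalves]
    refine ⟨⟨joinHalves (x', y'), hmem⟩, ⟨hmem, ?_, ?_⟩, multOfCoords_eq_iff.2 ⟨1, ?_, ?_⟩⟩
    · rwa [firstHalf_joinHalves]
    · rwa [secondHalf_joinHalves]
    · simp
    · simp

theorem exists_mem_intrinsicInterior_iff (σ : Equiv.Perm (Fin n)) (u : sortedCell xl xr yb yt n)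
    (w : Mult n (coordRect xl xr yb yt)) :
    (∃ v : sortedCell xl xr yb yt n, v.1 ∈ intrinsicInterior ℝ (sortedFace xl xr yb yt u.1) ∧
      cellMap σ v = w) ↔ multComp hx hy w = multComp hx hy (cellMap σ u) := by
  constructor
  · rintro ⟨v, hv, rfl⟩
    rw [mem_intrinsicInterior_sortedFace_iff u.2] at hv
    exact le_antisymm ((exists_mem_sortedFace_iff hx hy σ u _).1 ⟨v, hv.1, rfl⟩)
      ((exists_mem_sortedFace_iff hx hy σ v _).1 ⟨u, hv.2, rfl⟩)
  · intro h
    obtain ⟨v, hv, rfl⟩ := (exists_mem_sortedFace_iff hx hy σ u w).2 h.le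
    -- The reverse inequality gives a point on the face of `v` with the image of `u`; uniqueness of
    -- sorted coordinates makes it `u` itself.
    obtain ⟨u', hu', he⟩ := (exists_mem_sortedFace_iff hx hy σ v (cellMap σ u)).2 h.ge
    obtain rfl := eq_of_cellMap_eq he
    exact ⟨v, (mem_intrinsicInterior_sortedFace_iff u'.2).2 ⟨hv, hu'⟩, rfl⟩

theorem mem_image_multComplex_iff (σ : Equiv.Perm (Fin n))
    (F : Set (EuclideanSpace ℝ (Fin (n + n)))) (p : (multComplex n hx hy).Space) :
    p ∈ (multComplex n hx hy).image σ F ↔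
      ∃ v : sortedCell xl xr yb yt n, v.1 ∈ F ∧ cellMap σ v = multComplexMap n hx hy p := by
  constructor
  · rintro ⟨v, hv, rfl⟩
    exact ⟨v, hv, rfl⟩
  · rintro ⟨v, hv, h⟩
    exact ⟨v, hv, multComplexMap_injective hx hy h⟩

/-- Cells correspond to principal down-sets of compositions. As every composition occurs
(`exists_multComp_eq`), the bound `b` is determined by the cell, and inclusion of cells becomes the
order of the bounds. -/
theorem exists_mem_cell_iff (S : (multComplex n hx hy).FacePoset) :
    ∃ b : RectComp n, ∀ p, p ∈ S.1 ↔ multComp hx hy (multComplexMap n hx hy p) ≤ b := by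
  obtain ⟨S, σ, F, hF, rfl⟩ := S
  obtain ⟨u, hu, rfl⟩ := exists_eq_sortedFace (n := n) hF.1 hF.2
  exact ⟨multComp hx hy (cellMap σ ⟨u, hu⟩), fun p => (mem_image_multComplex_iff hx hy σ _ p).trans
    (exists_mem_sortedFace_iff hx hy σ ⟨u, hu⟩ _)⟩

/-- The composition of the multisets in the relative interior of a cell. -/
noncomputable def cellComp (S : (multComplex n hx hy).FacePoset) : RectComp n :=
  (exists_mem_cell_iff hx hy S).choose

theorem mem_cell_iff (S : (multComplex n hx hy).FacePoset) (p : (multComplex n hx hy).Space) :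
    p ∈ S.1 ↔ multComp hx hy (multComplexMap n hx hy p) ≤ cellComp hx hy S :=
  (exists_mem_cell_iff hx hy S).choose_spec p

theorem cellComp_toCell {σ : Equiv.Perm (Fin n)} {u : sortedCell xl xr yb yt n}
    (h : (multComplex n hx hy).IsFace σ (sortedFace xl xr yb yt u.1)) :
    cellComp hx hy h.toCell = multComp hx hy (cellMap σ u) := by
  have key : ∀ p, multComp hx hy (multComplexMap n hx hy p) ≤ cellComp hx hy h.toCell ↔
      multComp hx hy (multComplexMap n hx hy p) ≤ multComp hx hy (cellMap σ u) := fun p => by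
    rw [← mem_cell_iff, ← exists_mem_sortedFace_iff]
    exact mem_image_multComplex_iff hx hy σ _ p
  refine le_antisymm ?_ ?_
  · obtain ⟨p, hp⟩ := exists_multComp_eq hx hy (cellComp hx hy h.toCell)
    exact hp ▸ (key p).1 hp.le
  · obtain ⟨p, hp⟩ := exists_multComp_eq hx hy (multComp hx hy (cellMap σ u))
    exact hp ▸ (key p).2 hp.le

theorem cellComp_le_iff (S T : (multComplex n hx hy).FacePoset) :
    cellComp hx hy S ≤ cellComp hx hy T ↔ S ≤ T := by
  constructor
  · intro h p hp
    exact (mem_cell_iff hx hy T p).2 (((mem_cell_iff hx hy S p).1 hp).trans h)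
  · intro h
    obtain ⟨p, hp⟩ := exists_multComp_eq hx hy (cellComp hx hy S)
    exact hp ▸ (mem_cell_iff hx hy T p).1 (h ((mem_cell_iff hx hy S p).2 hp.le))

theorem isFace_sortedFace (σ : Equiv.Perm (Fin n)) (u : sortedCell xl xr yb yt n) :
    (multComplex n hx hy).IsFace σ (sortedFace xl xr yb yt u.1) :=
  ⟨isExposed_sortedFace u.2, u.1, mem_sortedFace_self u.2⟩

theorem cellComp_surjective :
    Function.Surjective (cellComp hx hy : (multComplex n hx hy).FacePoset → RectComp n) := by
  intro b
  obtain ⟨z, hz⟩ := exists_isMultiplicityMatrix_of_rectComp hx hy b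
  obtain ⟨σ, u, rfl⟩ := exists_cellMap_eq hx hy z
  refine ⟨(isFace_sortedFace hx hy σ u).toCell, ?_⟩
  rw [cellComp_toCell]
  exact (isMultiplicityMatrix_iff_multComp_eq hx hy).1 hz

/-- The face poset of the complex is the poset of rectangular compositions. -/
noncomputable def facePosetIso : (multComplex n hx hy).FacePoset ≃o RectComp n where
  toEquiv := Equiv.ofBijective (cellComp hx hy)
    ⟨fun S T h => le_antisymm ((cellComp_le_iff hx hy S T).1 h.le)
      ((cellComp_le_iff hx hy T S).1 h.ge), cellComp_surjective hx hy⟩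
  map_rel_iff' := cellComp_le_iff hx hy _ _

end FacePoset

/-! ### Transport along the isometry of `Q` with the rectangle, and the theorem. -/

namespace Mult

variable {n : ℕ} {X Y : Type*} [MetricSpace X] [MetricSpace Y]

theorem dist_map (e : X ≃ᵢ Y) (z w : Mult n X) : dist (z.map e) (w.map e) = dist z w := by
  obtain ⟨z, rfl⟩ := Quotient.exists_rep z
  obtain ⟨w, rfl⟩ := Quotient.exists_rep w
  have h2 : 0 < (2 : ℝ≥0∞).toReal := by norm_num
  change orbitDist (e ∘ z) (e ∘ w) = orbitDist z w
  unfold orbitDist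
  congr 1
  funext σ
  simp only [tupleDist, PiLp.dist_eq_sum h2, Function.comp, e.dist_eq]

/-- The isometry of multiset spaces induced by an isometry of spaces. -/
def mapIso (e : X ≃ᵢ Y) : Mult n X ≃ᵢ Mult n Y where
  toFun := map e
  invFun := map e.symm
  left_inv := by
    rintro ⟨z⟩
    exact congrArg mk (funext fun t => e.symm_apply_apply (z t))
  right_inv := by
    rintro ⟨z⟩
    exact congrArg mk (funext fun t => e.apply_symm_apply (z t))
  isometry_toFun := Isometry.of_dist_eq (dist_map e)

end Mult

theorem theoremA {Q : Type*} [MetricSpace Q] (xl xr yb yt : ℝ) (hx : xl < xr) (hy : yb < yt)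
    (e : Q ≃ᵢ (Set.Icc xl xr ×ℂ Set.Icc yb yt : Set ℂ)) (n : ℕ) (hn : 1 ≤ n) :
    ∃ (K : EuclideanComplex) (f : K.Space ≃ᵢ Mult n Q) (φ : K.FacePoset ≃o RectComp n),
      ∀ (i : K.ι) (F : Set (EuclideanSpace ℝ (Fin (K.dim i)))) (hF : K.IsFace i F),
        IsBiOrthoscheme F ∧
        f '' K.image i (intrinsicInterior ℝ F) =
          {z | IsMultiplicityMatrix xl xr yb yt (z.map e) (φ hF.toCell)} := by
  refine ⟨multComplex n hx hy, (multComplexIso hx hy).trans (Mult.mapIso e).symm,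
    facePosetIso hx hy, fun σ F hF => ?_⟩
  obtain ⟨u, hu, rfl⟩ := exists_eq_sortedFace (n := n) hF.1 hF.2
  refine ⟨isBiOrthoscheme_sortedFace hx hy hu, ?_⟩
  ext z
  have hφ : facePosetIso hx hy hF.toCell = multComp hx hy (cellMap σ ⟨u, hu⟩) :=
    cellComp_toCell hx hy (u := ⟨u, hu⟩) hF
  obtain ⟨p, rfl⟩ := ((multComplexIso hx hy).trans (Mult.mapIso (n := n) e).symm).surjective z
  have hp : Mult.map e (((multComplexIso hx hy).trans (Mult.mapIso (n := n) e).symm) p) =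
      multComplexMap n hx hy p := (Mult.mapIso e).apply_symm_apply (multComplexMap n hx hy p)
  rw [Function.Injective.mem_set_image (IsometryEquiv.injective _)]
  refine (mem_image_multComplex_iff hx hy σ _ p).trans
    ((exists_mem_intrinsicInterior_iff hx hy σ ⟨u, hu⟩ _).trans ?_)
  rw [← hφ, ← isMultiplicityMatrix_iff_multComp_eq, ← hp]
  rfl
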